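/- For positive integers $n\ge 2k$ let $SG(n,k)$ be the Schrijver graph: its vertices are the $k$-element subsets of $[n]$ that are independent in the cycle $C_n$ on $[n]$, and two of them are adjacent if they are disjoint. A graph quadrangulates a surface if it can be embedded in the surface so that every face is a quadrangle, that is, an open disc whose closure is a closed disc bounded by a 4-cycle of the graph. Let $k\ge 2$. For a graph $B$ on the vertex set $[2k+2]$, let $D(B)$ be the graph obtained from the Cartesian product $P_{k+1}\Box C_{2k+2}$ of a path and a cycle by adding the edges $(1,a)(1,b)$ for all edges $ab$ of $B$, and then identifying each vertex $(i,j)$ with its opposite vertex $(k+2-i,\,j+k+1)$ (second coordinates modulo $2k+2$; multiple edges are merged). Let $Y_k=D(B)$, where $B$ has the edges $a(a+k+1)$, $a\in[k+1]$, if $k$ is even, and the edges $a(a+k)$, $a\in[k+1]$, if $k$ is odd. Let $Z_k=D(B)$, where $B$ has the edges $ab$ with $a+b=2k+3$. Both graphs have the same vertex set. Then for every $k\ge2$: (a) there is a bijection from the common vertex set of $Y_k$ and $Z_k$ to the vertex set of $SG(2k+2,k)$ that maps every edge of $Y_k$ and every edge of $Z_k$ to an edge of $SG(2k+2,k)$;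 so $Y_k$ and $Z_k$ are (isomorphic to) spanning subgraphs of $SG(2k+2,k)$, and $Y_k\ne Z_k$; (b) $Y_k$ quadrangulates the Klein bottle; (c) $Z_k$ quadrangulates the projective plane. -/

import Mathlib

open unitInterval

/-! ### Kneser and Schrijver graphs -/

/-- The Kneser graph `KG(n,k)`: vertices are the `k`-element subsets of an `n`-element set,
two distinct ones being adjacent when they are disjoint. -/
def kneserGraph (n k : ℕ) : SimpleGraph {s : Finset (Fin n) // s.card = k} where
  Adj s t := s ≠ t ∧ Disjoint s.1 t.1
  symm := ⟨fun _ _ h => ⟨h.1.symm, h.2.symm⟩⟩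
  loopless := ⟨fun _ h => h.1 rfl⟩

/-- The vertices of the Schrijver graph: `k`-subsets that are independent in the cycle `C_n`. -/
def schrijverSet (n k : ℕ) : Set {s : Finset (Fin n) // s.card = k} :=
  {s | (SimpleGraph.cycleGraph n).IsIndepSet (s.1 : Set (Fin n))}

/-- The Schrijver graph `SG(n,k)`, an induced subgraph of the Kneser graph. -/
def schrijverGraph (n k : ℕ) : SimpleGraph (schrijverSet n k) :=
  (kneserGraph n k).induce (schrijverSet n k)

/-! ### The graphs `Y_k` and `Z_k`

Rows are indexed by `Fin (k+1)` and positions on the cycle `C_{2k+2}` by `Fin (2k+2)`, both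
counted from `0`. -/

/-- Opposite vertices `(i, j)` and `(k - i, j + (k+1))` (second coordinate modulo `2k+2`) of the
drum of height `k+1` and perimeter `2k+2`. -/
def AreOpposite (k : ℕ) (p q : Fin (k + 1) × Fin (2 * k + 2)) : Prop :=
  p.1.val + q.1.val = k ∧ (q.2.val = p.2.val + (k + 1) ∨ p.2.val = q.2.val + (k + 1))

/-- The identification of opposite vertices. -/
def oppositeSetoid (k : ℕ) : Setoid (Fin (k + 1) × Fin (2 * k + 2)) where
  r p q := p = q ∨ AreOpposite k p q
  iseqv := by
    refine ⟨fun p => Or.inl rfl, ?_, ?_⟩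
    · rintro ⟨⟨a, ha⟩, ⟨b, hb⟩⟩ ⟨⟨c, hc⟩, ⟨d, hd⟩⟩ h
      simp only [AreOpposite, Prod.mk.injEq, Fin.mk.injEq] at h ⊢
      omega
    · rintro ⟨⟨a, ha⟩, ⟨b, hb⟩⟩ ⟨⟨c, hc⟩, ⟨d, hd⟩⟩ ⟨⟨e, he⟩, ⟨f, hf⟩⟩ h h'
      simp only [AreOpposite, Prod.mk.injEq, Fin.mk.injEq] at h h' ⊢
      omega

/-- The vertex set of the reduced drum: pairs of opposite vertices. -/
def DrumVertex (k : ℕ) : Type := Quotient (oppositeSetoid k)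

/-- A graph `B` on the cyclic positions, placed on the bottom row `0`. -/
def bottomRow (k : ℕ) (B : SimpleGraph (Fin (2 * k + 2))) :
    SimpleGraph (Fin (k + 1) × Fin (2 * k + 2)) :=
  B.map (fun j => ((0 : Fin (k + 1)), j))

/-- The graph `P_{k+1} □ C_{2k+2}` with the edges of `B` added on its bottom row, after
identification of all pairs of opposite vertices. (The identification carries the top row
onto the bottom row.) -/
def drumWith (k : ℕ) (B : SimpleGraph (Fin (2 * k + 2))) : SimpleGraph (DrumVertex k) :=
  ((SimpleGraph.pathGraph (k + 1) □ SimpleGraph.cycleGraph (2 * k + 2)) ⊔ bottomRow k B).map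
    (Quotient.mk (oppositeSetoid k))

/-- The extra edges on the bottom row of `Y_k`: for even `k` the pairs `a, a + (k+1)` of opposite
vertices of `C_{2k+2}`; for odd `k` the pairs `a, a + k` for the first `k+1` positions `a`. -/
def extraY (k : ℕ) : SimpleGraph (Fin (2 * k + 2)) :=
  SimpleGraph.fromRel fun a b =>
    (Even k ∧ b.val = a.val + (k + 1)) ∨ (Odd k ∧ a.val ≤ k ∧ b.val = a.val + k)

/-- The extra edges on the bottom row of `Z_k`: the pairs `a, b` with `a + b = 2k+1`, which
together with `C_{2k+2}` form a ladder `P_{k+1} □ P_2` (its two end rungs lie in `C_{2k+2}`). -/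
def extraZ (k : ℕ) : SimpleGraph (Fin (2 * k + 2)) :=
  SimpleGraph.fromRel fun a b => a.val + b.val = 2 * k + 1

/-- The graph `Y_k`. -/
def graphY (k : ℕ) : SimpleGraph (DrumVertex k) := drumWith k (extraY k)

/-- The graph `Z_k`. -/
def graphZ (k : ℕ) : SimpleGraph (DrumVertex k) := drumWith k (extraZ k)

/-! ### The two surfaces -/

/-- Orbits of the plane under the group generated by the glide reflection
`(x, y) ↦ (x + 1, -y)` and the translation `(x, y) ↦ (x, y + 1)`. -/
def kleinSetoid : Setoid (ℝ × ℝ) where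
  r p q := ∃ m n : ℤ, q.1 = p.1 + m ∧ q.2 = (-1 : ℝ) ^ m * p.2 + n
  iseqv := by
    have key (m : ℤ) : ∃ s : ℤ, (-1 : ℝ) ^ m = s ∧ s * s = 1 := by
      rcases Int.even_or_odd m with h | h
      · exact ⟨1, by simp [h.neg_one_zpow], by norm_num⟩
      · exact ⟨-1, by simp [h.neg_one_zpow], by norm_num⟩
    refine ⟨fun p => ⟨0, 0, by simp, by simp⟩, ?_, ?_⟩
    · rintro p q ⟨m, n, h₁, h₂⟩
      obtain ⟨s, hs, hs'⟩ := key m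
      have hsR : (s : ℝ) * s = 1 := by exact_mod_cast hs'
      refine ⟨-m, -(s * n), by push_cast; linarith, ?_⟩
      have : (-1 : ℝ) ^ (-m) = s := by
        rw [zpow_neg, hs]; exact inv_eq_of_mul_eq_one_left hsR
      rw [this, h₂, hs]; push_cast
      linear_combination (-p.2) * hsR
    · rintro p q r ⟨m, n, h₁, h₂⟩ ⟨m', n', h₁', h₂'⟩
      obtain ⟨s, hs, -⟩ := key m'
      refine ⟨m + m', s * n + n', by push_cast; linarith, ?_⟩
      rw [zpow_add₀ (by norm_num), h₂', h₂, hs]; push_cast; ring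

/-- The Klein bottle. -/
def KleinBottle : Type := Quotient kleinSetoid

instance : TopologicalSpace KleinBottle := inferInstanceAs (TopologicalSpace (Quotient kleinSetoid))

/-- The real projective plane: the space of lines through the origin of `ℝ³`. -/
def RealProjectivePlane : Type := Projectivization ℝ (Fin 3 → ℝ)

/-- The quotient topology from `ℝ³ \ {0}`. -/
instance : TopologicalSpace RealProjectivePlane :=
  inferInstanceAs (TopologicalSpace (Quotient (projectivizationSetoid ℝ (Fin 3 → ℝ))))

/-! ### Embeddings of graphs in surfaces -/

/-- An embedding (a drawing without crossings) of a graph in a topological space: distinct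
vertices are distinct points, each edge is a simple arc joining its ends (parametrized once for
each of its two orientations), an arc meets the vertices only at its ends, and two different
edges meet at most in common ends. -/
structure GraphEmbedding {V : Type*} (G : SimpleGraph V) (S : Type*) [TopologicalSpace S] where
  point : V → S
  point_injective : Function.Injective point
  arc (d : G.Dart) : Path (point d.fst) (point d.snd)
  arc_symm (d : G.Dart) (t : I) : arc d.symm t = arc d (σ t)
  arc_injective (d : G.Dart) : Function.Injective (arc d)
  arc_avoids (d : G.Dart) (t : I) (v : V) : arc d t = point v → t = 0 ∨ t = 1
  arc_disjoint (d e : G.Dart) (s t : I) :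
    d.edge ≠ e.edge → arc d s = arc e t → s = 0 ∨ s = 1

namespace GraphEmbedding

variable {V : Type*} {G : SimpleGraph V} {S : Type*} [TopologicalSpace S]

/-- The set of points of the surface covered by the drawing. -/
def carrier (E : GraphEmbedding G S) : Set S :=
  Set.range E.point ∪ ⋃ d : G.Dart, Set.range (E.arc d)

/-- The faces are the connected components of the complement of the drawing. -/
def IsFace (E : GraphEmbedding G S) (F : Set S) : Prop :=
  ∃ x ∈ E.carrierᶜ, F = connectedComponentIn E.carrierᶜ x

/-- `F` is a quadrangle: it is the interior of a closed disc, embedded in the surface, whose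
boundary runs around a 4-cycle of the graph. The disc is parametrized by the unit square, whose
four sides are, in cyclic order, the arcs of the four edges of the cycle; that these edges are
consecutive and the four vertices distinct follows, as the square is embedded. -/
def IsQuadrangle (E : GraphEmbedding G S) (F : Set S) : Prop :=
  ∃ φ : I × I → S, Topology.IsEmbedding φ ∧
    φ '' (Set.Ioo 0 1 ×ˢ Set.Ioo 0 1) = F ∧
    ∃ d₀ d₁ d₂ d₃ : G.Dart, ∀ t : I,
      φ (t, 0) = E.arc d₀ t ∧ φ (1, t) = E.arc d₁ t ∧
      φ (σ t, 1) = E.arc d₂ t ∧ φ (0, σ t) = E.arc d₃ t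

end GraphEmbedding

/-- A graph quadrangulates a surface if it can be embedded in it so that all faces are
quadrangles. -/
def Quadrangulates {V : Type*} (G : SimpleGraph V) (S : Type*) [TopologicalSpace S] : Prop :=
  ∃ E : GraphEmbedding G S, ∀ F : Set S, E.IsFace F → E.IsQuadrangle F

/-! ### Square decompositions of a space -/

/-! The combinatorial half. Call a position of `C_{2k+2}` a break of an independent set `s` if
neither it nor its successor lies in `s`. Every position lies in `s`, precedes an element of `s`, or
is a break, exclusively; so a `k`-set has exactly two breaks (`two_mul_card_add_card_breaks`). Away
from the breaks membership alternates, so the breaks determine the set and their distance is odd.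
Send the drum vertex in row `i` at position `j` to the set with breaks `j - i` and `j + i + 1`. Its
opposite vertex has the same two breaks in the other order, so this descends to a bijection
`drumStable`. A drum edge moves each break by one step, which makes the two sets disjoint. The sets
of row `0` are contained in one parity class, the one opposite to their position, so an extra edge
`ab` is harmless as soon as `a + b` is odd. This holds in `Y_k` and `Z_k`, and is why the edges of
`Y_k` depend on the parity of `k`. The graphs differ because in `Z_k` the vertex of row `0` at
position `0` gains no neighbour.

The topological half. The drum is a quadrangulated annulus and the identification of opposite points
turns it into a Möbius band, with `[0, k+1] × [0, k]` as fundamental domain, whose boundary is the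
cycle of length `2k+2` in row `0`. A second Möbius band glued along that cycle gives the Klein
bottle, a disc gives the projective plane. The extra edges cut the added piece into quadrangles:
crossing rungs in the Möbius band for `Y_k`, the rungs of a ladder in the disc for `Z_k`.

To make this rigorous, a surface is partitioned explicitly into points, open arcs and open squares
with embedded closures (`SquareDecomposition`). In a Hausdorff space such a finite partition is a
quadrangulation: each open square is open, because its complement is a finite union of compact sets,
and hence is a component of the complement of the graph. The drum part is common to both surfaces
and is treated once, from an abstract chart (`DrumFilling`). The Klein bottle is filled in
coordinates of the plane (`kleinFillingEven`, `kleinFillingOdd`). The projective plane is the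
boundary of a `k × 1 × k` box modulo its centre (`rpFilling`): front and right side carry the drum,
the top carries the disc. -/

/-- `g` runs along one of the given arcs on the unit interval, in one of its two directions. -/
def IsSideOf {E S : Type*} (arc : E → ℝ → S) (g : ℝ → S) : Prop :=
  ∃ e, (∀ t ∈ Set.Icc (0 : ℝ) 1, g t = arc e t) ∨ ∀ t ∈ Set.Icc (0 : ℝ) 1, g t = arc e (1 - t)

/-- A decomposition of a space `S` into points (the vertices of `G`), open arcs (the edges of `G`)
and open squares whose closures are embedded closed squares with sides among the arcs. -/
structure SquareDecomposition {V : Type*} (G : SimpleGraph V) (S : Type*) [TopologicalSpace S]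
    (E F : Type*) where
  point : V → S
  src : E → V
  tgt : E → V
  arc : E → ℝ → S
  face : F → ℝ × ℝ → S
  arc_continuous (e : E) : Continuous (arc e)
  face_continuous (f : F) : Continuous (face f)
  arc_zero (e : E) : arc e 0 = point (src e)
  arc_one (e : E) : arc e 1 = point (tgt e)
  adj_iff (u v : V) : G.Adj u v ↔ ∃ e, s(src e, tgt e) = s(u, v)
  edge_injective : Function.Injective fun e => s(src e, tgt e)
  side_bottom (f : F) : IsSideOf arc fun t => face f (t, 0)
  side_right (f : F) : IsSideOf arc fun t => face f (1, t)
  side_top (f : F) : IsSideOf arc fun t => face f (t, 1)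
  side_left (f : F) : IsSideOf arc fun t => face f (0, t)
  face_injOn (f : F) : Set.InjOn (face f) (Set.Icc 0 1 ×ˢ Set.Icc 0 1)
  point_injective : Function.Injective point
  arc_ne_point (e : E) (t : ℝ) (v : V) : t ∈ Set.Ioo (0 : ℝ) 1 → arc e t ≠ point v
  face_ne_point (f : F) (z : ℝ × ℝ) (v : V) : z ∈ Set.Ioo (0 : ℝ) 1 ×ˢ Set.Ioo (0 : ℝ) 1 →
    face f z ≠ point v
  face_ne_arc (f : F) (z : ℝ × ℝ) (e : E) (t : ℝ) : z ∈ Set.Ioo (0 : ℝ) 1 ×ˢ Set.Ioo (0 : ℝ) 1 →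
    t ∈ Set.Ioo (0 : ℝ) 1 → face f z ≠ arc e t
  arc_inj (e e' : E) (t t' : ℝ) : t ∈ Set.Ioo (0 : ℝ) 1 → t' ∈ Set.Ioo (0 : ℝ) 1 →
    arc e t = arc e' t' → e = e' ∧ t = t'
  face_inj (f f' : F) (z z' : ℝ × ℝ) : z ∈ Set.Ioo (0 : ℝ) 1 ×ˢ Set.Ioo (0 : ℝ) 1 →
    z' ∈ Set.Ioo (0 : ℝ) 1 ×ˢ Set.Ioo (0 : ℝ) 1 → face f z = face f' z' → f = f'
  cover (p : S) : (∃ v, point v = p) ∨ (∃ e, ∃ t ∈ Set.Ioo (0 : ℝ) 1, arc e t = p) ∨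
    ∃ f, ∃ z ∈ Set.Ioo (0 : ℝ) 1 ×ˢ Set.Ioo (0 : ℝ) 1, face f z = p

namespace SquareDecomposition

variable {V : Type*} {G : SimpleGraph V} {S : Type*} [TopologicalSpace S] {E F : Type*}
  (X : SquareDecomposition G S E F)

theorem src_ne_tgt (e : E) : X.src e ≠ X.tgt e :=
  ((X.adj_iff _ _).2 ⟨e, rfl⟩).ne

/-- The edge underlying a dart. -/
noncomputable def dartEdge (d : G.Dart) : E := ((X.adj_iff _ _).1 d.adj).choose

theorem dartEdge_spec (d : G.Dart) :
    s(X.src (X.dartEdge d), X.tgt (X.dartEdge d)) = s(d.fst, d.snd) :=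
  ((X.adj_iff _ _).1 d.adj).choose_spec

theorem dartEdge_symm (d : G.Dart) : X.dartEdge d.symm = X.dartEdge d := by
  apply X.edge_injective
  simp only [dartEdge_spec]
  exact Sym2.eq_swap

theorem dartEdge_eq (d : G.Dart) {e : E} (h : s(X.src e, X.tgt e) = s(d.fst, d.snd)) :
    X.dartEdge d = e :=
  X.edge_injective ((X.dartEdge_spec d).trans h.symm)

open Classical in
/-- The parametrised arc along a dart. -/
noncomputable def dartArc (d : G.Dart) (t : ℝ) : S :=
  if X.src (X.dartEdge d) = d.fst then X.arc (X.dartEdge d) t else X.arc (X.dartEdge d) (1 - t)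

theorem dartArc_cases (d : G.Dart) :
    (X.src (X.dartEdge d) = d.fst ∧ X.tgt (X.dartEdge d) = d.snd ∧
      X.dartArc d = X.arc (X.dartEdge d)) ∨
    (X.src (X.dartEdge d) = d.snd ∧ X.tgt (X.dartEdge d) = d.fst ∧
      X.dartArc d = fun t => X.arc (X.dartEdge d) (1 - t)) := by
  rcases Sym2.eq_iff.1 (X.dartEdge_spec d) with h | h
  · left
    refine ⟨h.1, h.2, ?_⟩
    ext t
    simp [dartArc, h.1]
  · right
    refine ⟨h.1, h.2, ?_⟩
    ext t
    have : X.src (X.dartEdge d) ≠ d.fst := by rw [h.1]; exact d.adj.ne.symm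
    simp [dartArc, this]

theorem dartArc_continuous (d : G.Dart) : Continuous (X.dartArc d) := by
  rcases X.dartArc_cases d with ⟨-, -, h⟩ | ⟨-, -, h⟩ <;> rw [h]
  · exact X.arc_continuous _
  · exact (X.arc_continuous _).comp (by fun_prop)

theorem dartArc_zero (d : G.Dart) : X.dartArc d 0 = X.point d.fst := by
  rcases X.dartArc_cases d with ⟨h1, h2, h⟩ | ⟨h1, h2, h⟩ <;> rw [h]
  · rw [X.arc_zero, h1]
  · simp only [sub_zero]
    rw [X.arc_one, h2]

theorem dartArc_one (d : G.Dart) : X.dartArc d 1 = X.point d.snd := by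
  rcases X.dartArc_cases d with ⟨h1, h2, h⟩ | ⟨h1, h2, h⟩ <;> rw [h]
  · rw [X.arc_one, h2]
  · simp only [sub_self]
    rw [X.arc_zero, h1]

theorem dartArc_symm (d : G.Dart) (t : ℝ) : X.dartArc d.symm t = X.dartArc d (1 - t) := by
  have hs := X.dartEdge_symm d
  rcases X.dartArc_cases d with ⟨h1, h2, h⟩ | ⟨h1, h2, h⟩ <;>
  rcases X.dartArc_cases d.symm with ⟨h1', h2', h'⟩ | ⟨h1', h2', h'⟩ <;> rw [h, h', hs]
  · rw [hs, h1] at h1'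
    exact absurd h1' d.adj.ne
  · simp
  · rw [hs, h1] at h1'
    exact absurd h1' d.adj.ne.symm

theorem dartArc_exists (d : G.Dart) {t : ℝ} (ht : t ∈ Set.Ioo (0 : ℝ) 1) :
    ∃ t' ∈ Set.Ioo (0 : ℝ) 1, X.dartArc d t = X.arc (X.dartEdge d) t' := by
  rcases X.dartArc_cases d with ⟨-, -, h⟩ | ⟨-, -, h⟩
  · exact ⟨t, ht, by rw [h]⟩
  · exact ⟨1 - t, ⟨by linarith [ht.2], by linarith [ht.1]⟩, by rw [h]⟩

theorem dartArc_inj_Ioo (d : G.Dart) {s t : ℝ} (hs : s ∈ Set.Ioo (0 : ℝ) 1)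
    (ht : t ∈ Set.Ioo (0 : ℝ) 1) (h : X.dartArc d s = X.dartArc d t) : s = t := by
  rcases X.dartArc_cases d with ⟨-, -, h'⟩ | ⟨-, -, h'⟩ <;> rw [h'] at h
  · exact (X.arc_inj _ _ _ _ hs ht h).2
  · have := (X.arc_inj _ _ _ _ ⟨by linarith [hs.2], by linarith [hs.1]⟩
      ⟨by linarith [ht.2], by linarith [ht.1]⟩ h).2
    linarith

theorem mem_unit_cases {t : ℝ} (ht : t ∈ Set.Icc (0 : ℝ) 1) :
    t = 0 ∨ t = 1 ∨ t ∈ Set.Ioo (0 : ℝ) 1 := by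
  rcases ht.1.eq_or_lt with h | h
  · exact Or.inl h.symm
  · rcases ht.2.eq_or_lt with h' | h'
    · exact Or.inr (Or.inl h')
    · exact Or.inr (Or.inr ⟨h, h'⟩)

theorem dartArc_ne_point (d : G.Dart) {t : ℝ} (ht : t ∈ Set.Ioo (0 : ℝ) 1) (v : V) :
    X.dartArc d t ≠ X.point v := by
  obtain ⟨t', ht', h⟩ := X.dartArc_exists d ht
  rw [h]
  exact X.arc_ne_point _ _ _ ht'

theorem dartArc_injOn (d : G.Dart) : Set.InjOn (X.dartArc d) (Set.Icc 0 1) := by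
  intro s hs t ht h
  have h01 : X.dartArc d 0 ≠ X.dartArc d 1 := by
    rw [X.dartArc_zero, X.dartArc_one]
    exact fun h => d.adj.ne (X.point_injective h)
  rcases mem_unit_cases hs with rfl | rfl | hs' <;> rcases mem_unit_cases ht with rfl | rfl | ht'
  · rfl
  · exact absurd h h01
  · exact absurd (h.symm.trans (X.dartArc_zero d)) (X.dartArc_ne_point d ht' _)
  · exact absurd h.symm h01
  · rfl
  · exact absurd (h.symm.trans (X.dartArc_one d)) (X.dartArc_ne_point d ht' _)
  · exact absurd (h.trans (X.dartArc_zero d)) (X.dartArc_ne_point d hs' _)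
  · exact absurd (h.trans (X.dartArc_one d)) (X.dartArc_ne_point d hs' _)
  · exact X.dartArc_inj_Ioo d hs' ht' h

theorem coe_mem_Ioo {t : I} (h0 : t ≠ 0) (h1 : t ≠ 1) : (t : ℝ) ∈ Set.Ioo (0 : ℝ) 1 := by
  rcases mem_unit_cases t.2 with h | h | h
  · exact absurd (Subtype.ext h) h0
  · exact absurd (Subtype.ext h) h1
  · exact h

/-- The drawing of the graph given by a square decomposition. -/
noncomputable def embedding : GraphEmbedding G S where
  point := X.point
  point_injective := X.point_injective
  arc d :=
    { toFun := fun t => X.dartArc d t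
      continuous_toFun := (X.dartArc_continuous d).comp continuous_subtype_val
      source' := by simpa using X.dartArc_zero d
      target' := by simpa using X.dartArc_one d }
  arc_symm d t := X.dartArc_symm d t
  arc_injective d s t h := Subtype.ext (X.dartArc_injOn d s.2 t.2 h)
  arc_avoids d t v h := by
    by_contra hc
    push Not at hc
    exact X.dartArc_ne_point d (coe_mem_Ioo hc.1 hc.2) v h
  arc_disjoint d e s t hde h := by
    by_contra hc
    push Not at hc
    obtain ⟨s', hs', h1⟩ := X.dartArc_exists d (coe_mem_Ioo hc.1 hc.2)
    replace h : X.dartArc d s = X.dartArc e t := h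
    rcases mem_unit_cases t.2 with ht | ht | ht
    · rw [ht, X.dartArc_zero] at h
      exact X.dartArc_ne_point d (coe_mem_Ioo hc.1 hc.2) _ h
    · rw [ht, X.dartArc_one] at h
      exact X.dartArc_ne_point d (coe_mem_Ioo hc.1 hc.2) _ h
    · obtain ⟨t', ht', h2⟩ := X.dartArc_exists e ht
      rw [h1, h2] at h
      have h3 := (X.arc_inj _ _ _ _ hs' ht' h).1
      have h4 := X.dartEdge_spec d
      rw [h3, X.dartEdge_spec e] at h4
      exact hde h4.symm

theorem embedding_arc_apply (d : G.Dart) (t : I) : X.embedding.arc d t = X.dartArc d t := rfl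

theorem exists_dart_of_isSideOf {g : ℝ → S} (h : IsSideOf X.arc g) :
    ∃ d : G.Dart, ∀ t : I, g t = X.embedding.arc d t := by
  obtain ⟨e, h⟩ := h
  let d : G.Dart := ⟨(X.src e, X.tgt e), (X.adj_iff _ _).2 ⟨e, rfl⟩⟩
  have hd : X.dartEdge d = e := X.dartEdge_eq d rfl
  have h1 : X.dartArc d = X.arc e := by
    rcases X.dartArc_cases d with ⟨-, -, h'⟩ | ⟨h1, -, -⟩
    · rw [h', hd]
    · rw [hd] at h1
      exact absurd h1 (X.src_ne_tgt e)
  rcases h with h | h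
  · exact ⟨d, fun t => by rw [h _ t.2, embedding_arc_apply, h1]⟩
  · exact ⟨d.symm, fun t => by rw [h _ t.2, embedding_arc_apply, dartArc_symm, h1]⟩

theorem exists_dart_of_isSideOf_reverse {g : ℝ → S} (h : IsSideOf X.arc g) :
    ∃ d : G.Dart, ∀ t : I, g (σ t : I) = X.embedding.arc d t := by
  obtain ⟨d, hd⟩ := X.exists_dart_of_isSideOf h
  exact ⟨d.symm, fun t => by rw [X.embedding.arc_symm, hd]⟩

theorem mem_carrier_iff (p : S) : p ∈ X.embedding.carrier ↔
    (∃ v, X.point v = p) ∨ ∃ e, ∃ t ∈ Set.Ioo (0 : ℝ) 1, X.arc e t = p := by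
  constructor
  · rintro (⟨v, rfl⟩ | h)
    · exact Or.inl ⟨v, rfl⟩
    · obtain ⟨d, t, rfl⟩ := Set.mem_iUnion.1 h
      rw [embedding_arc_apply]
      rcases mem_unit_cases t.2 with ht | ht | ht
      · exact Or.inl ⟨d.fst, by rw [ht, dartArc_zero]⟩
      · exact Or.inl ⟨d.snd, by rw [ht, dartArc_one]⟩
      · obtain ⟨t', ht', h'⟩ := X.dartArc_exists d ht
        exact Or.inr ⟨_, t', ht', h'.symm⟩
  · rintro (⟨v, rfl⟩ | ⟨e, t, ht, rfl⟩)
    · exact Or.inl ⟨v, rfl⟩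
    · right
      obtain ⟨d, hd⟩ := X.exists_dart_of_isSideOf (g := X.arc e) ⟨e, Or.inl fun _ _ => rfl⟩
      exact Set.mem_iUnion.2 ⟨d, ⟨t, Set.Ioo_subset_Icc_self ht⟩, (hd _).symm⟩

/-- The open face of a square decomposition. -/
def openFace (f : F) : Set S := X.face f '' (Set.Ioo 0 1 ×ˢ Set.Ioo 0 1)

theorem mem_closedFace_cases (f : F) {z : ℝ × ℝ} (hz : z ∈ Set.Icc (0 : ℝ) 1 ×ˢ Set.Icc (0 : ℝ) 1) :
    z ∈ Set.Ioo (0 : ℝ) 1 ×ˢ Set.Ioo (0 : ℝ) 1 ∨ X.face f z ∈ X.embedding.carrier := by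
  have key {g : ℝ → S} (h : IsSideOf X.arc g) {t : ℝ} (ht : t ∈ Set.Icc (0 : ℝ) 1) :
      g t ∈ X.embedding.carrier := by
    obtain ⟨d, hd⟩ := X.exists_dart_of_isSideOf h
    exact Or.inr (Set.mem_iUnion.2 ⟨d, ⟨t, ht⟩, (hd ⟨t, ht⟩).symm⟩)
  obtain ⟨s, t⟩ := z
  obtain ⟨hs, ht⟩ := hz
  rcases mem_unit_cases hs with rfl | rfl | hs'
  · exact Or.inr (key (X.side_left f) ht)
  · exact Or.inr (key (X.side_right f) ht)
  · rcases mem_unit_cases ht with rfl | rfl | ht'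
    · exact Or.inr (key (X.side_bottom f) hs)
    · exact Or.inr (key (X.side_top f) hs)
    · exact Or.inl ⟨hs', ht'⟩

theorem openFace_disjoint_carrier (f : F) : X.openFace f ⊆ X.embedding.carrierᶜ := by
  rintro _ ⟨z, hz, rfl⟩ h
  rcases (X.mem_carrier_iff _).1 h with ⟨v, hv⟩ | ⟨e, t, ht, h⟩
  · exact X.face_ne_point f z v hz hv.symm
  · exact X.face_ne_arc f z e t hz ht h.symm

theorem isClosed_carrier [T2Space S] [Finite V] [Finite E] : IsClosed X.embedding.carrier := by
  have : X.embedding.carrier =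
      Set.range X.point ∪ ⋃ e, X.arc e '' Set.Icc 0 1 := by
    ext p
    rw [mem_carrier_iff]
    constructor
    · rintro (h | ⟨e, t, ht, rfl⟩)
      · exact Or.inl h
      · exact Or.inr (Set.mem_iUnion.2 ⟨e, t, Set.Ioo_subset_Icc_self ht, rfl⟩)
    · rintro (h | h)
      · exact Or.inl h
      · obtain ⟨e, t, ht, rfl⟩ := Set.mem_iUnion.1 h
        rcases mem_unit_cases ht with rfl | rfl | ht'
        · exact Or.inl ⟨_, (X.arc_zero e).symm⟩
        · exact Or.inl ⟨_, (X.arc_one e).symm⟩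
        · exact Or.inr ⟨e, t, ht', rfl⟩
  rw [this]
  refine (Set.finite_range _).isClosed.union (isClosed_iUnion_of_finite fun e => ?_)
  exact (isCompact_Icc.image (X.arc_continuous e)).isClosed

/-- The complement is the drawing together with the other closed squares, since the boundary of a
square lies in the drawing. This is a finite union of compact sets, closed in a Hausdorff space. -/
theorem isOpen_openFace [T2Space S] [Finite V] [Finite E] [Finite F] (f : F) :
    IsOpen (X.openFace f) := by
  have : (X.openFace f)ᶜ = X.embedding.carrier ∪
      ⋃ f' : {f' // f' ≠ f}, X.face f' '' (Set.Icc 0 1 ×ˢ Set.Icc 0 1) := by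
    ext p
    constructor
    · intro hp
      rcases X.cover p with h | h | ⟨f', z, hz, rfl⟩
      · exact Or.inl ((X.mem_carrier_iff p).2 (Or.inl h))
      · exact Or.inl ((X.mem_carrier_iff p).2 (Or.inr h))
      · right
        refine Set.mem_iUnion.2 ⟨⟨f', ?_⟩, z, Set.prod_mono Set.Ioo_subset_Icc_self
          Set.Ioo_subset_Icc_self hz, rfl⟩
        rintro rfl
        exact hp ⟨z, hz, rfl⟩
    · rintro (h | h) hp
      · exact X.openFace_disjoint_carrier f hp h
      · obtain ⟨⟨f', hf'⟩, z, hz, rfl⟩ := Set.mem_iUnion.1 h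
        rcases X.mem_closedFace_cases f' hz with hz' | hz'
        · obtain ⟨w, hw, h⟩ := hp
          exact hf' (X.face_inj _ _ _ _ hw hz' h).symm
        · exact X.openFace_disjoint_carrier f hp hz'
  rw [← isClosed_compl_iff, this]
  refine X.isClosed_carrier.union (isClosed_iUnion_of_finite fun f' => ?_)
  exact ((isCompact_Icc.prod isCompact_Icc).image (X.face_continuous _)).isClosed

/-- The open squares are open, pairwise disjoint and cover the complement of the drawing, so a
connected set there cannot leave the square it meets; conversely a square is connected. -/
theorem connectedComponentIn_eq_openFace [T2Space S] [Finite V] [Finite E] [Finite F] (f : F)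
    {p : S} (hp : p ∈ X.openFace f) :
    connectedComponentIn X.embedding.carrierᶜ p = X.openFace f := by
  apply Set.Subset.antisymm
  · have hc := (isPreconnected_connectedComponentIn (F := X.embedding.carrierᶜ) (x := p))
    refine hc.subset_left_of_subset_union (X.isOpen_openFace f)
      (v := ⋃ f' : {f' // f' ≠ f}, X.openFace f') (isOpen_iUnion fun f' => X.isOpen_openFace _)
      ?_ ?_ ⟨p, mem_connectedComponentIn (X.openFace_disjoint_carrier f hp), hp⟩
    · rw [Set.disjoint_left]
      rintro _ ⟨z, hz, rfl⟩ h
      obtain ⟨⟨f', hf'⟩, w, hw, h⟩ := Set.mem_iUnion.1 h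
      exact hf' (X.face_inj _ _ _ _ hw hz h)
    · intro q hq
      have hq' := connectedComponentIn_subset _ _ hq
      rcases X.cover q with h | h | ⟨f', z, hz, rfl⟩
      · exact absurd ((X.mem_carrier_iff q).2 (Or.inl h)) hq'
      · exact absurd ((X.mem_carrier_iff q).2 (Or.inr h)) hq'
      · by_cases hf : f' = f
        · subst hf
          exact Or.inl ⟨z, hz, rfl⟩
        · exact Or.inr (Set.mem_iUnion.2 ⟨⟨f', hf⟩, z, hz, rfl⟩)
  · refine IsPreconnected.subset_connectedComponentIn ?_ hp (X.openFace_disjoint_carrier f)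
    exact (isPreconnected_Ioo.prod isPreconnected_Ioo).image _ (X.face_continuous f).continuousOn

theorem openFace_isQuadrangle [T2Space S] (f : F) : X.embedding.IsQuadrangle (X.openFace f) := by
  refine ⟨fun z => X.face f (z.1, z.2), ?_, ?_, ?_⟩
  · refine (Continuous.isClosedEmbedding ?_ ?_).isEmbedding
    · exact (X.face_continuous f).comp (by fun_prop)
    · rintro ⟨s, t⟩ ⟨s', t'⟩ h
      have := X.face_injOn f ⟨s.2, t.2⟩ ⟨s'.2, t'.2⟩ h
      simp only [Prod.mk.injEq] at this
      exact Prod.ext (Subtype.ext this.1) (Subtype.ext this.2)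
  · ext p
    constructor
    · rintro ⟨⟨s, t⟩, ⟨hs, ht⟩, rfl⟩
      exact ⟨(s, t), ⟨⟨hs.1, hs.2⟩, ⟨ht.1, ht.2⟩⟩, rfl⟩
    · rintro ⟨⟨s, t⟩, ⟨hs, ht⟩, rfl⟩
      exact ⟨(⟨s, Set.Ioo_subset_Icc_self hs⟩, ⟨t, Set.Ioo_subset_Icc_self ht⟩),
        ⟨⟨hs.1, hs.2⟩, ⟨ht.1, ht.2⟩⟩, rfl⟩
  · obtain ⟨d₀, h₀⟩ := X.exists_dart_of_isSideOf (X.side_bottom f)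
    obtain ⟨d₁, h₁⟩ := X.exists_dart_of_isSideOf (X.side_right f)
    obtain ⟨d₂, h₂⟩ := X.exists_dart_of_isSideOf_reverse (X.side_top f)
    obtain ⟨d₃, h₃⟩ := X.exists_dart_of_isSideOf_reverse (X.side_left f)
    exact ⟨d₀, d₁, d₂, d₃, fun t => ⟨h₀ t, h₁ t, h₂ t, h₃ t⟩⟩

theorem quadrangulates [T2Space S] [Finite V] [Finite E] [Finite F]
    (X : SquareDecomposition G S E F) : Quadrangulates G S := by
  refine ⟨X.embedding, ?_⟩
  rintro _ ⟨p, hp, rfl⟩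
  rcases X.cover p with h | h | ⟨f, z, hz, rfl⟩
  · exact absurd ((X.mem_carrier_iff p).2 (Or.inl h)) hp
  · exact absurd ((X.mem_carrier_iff p).2 (Or.inr h)) hp
  · rw [X.connectedComponentIn_eq_openFace f ⟨z, hz, rfl⟩]
    exact X.openFace_isQuadrangle f

end SquareDecomposition

/-! ### The drum with identified opposite points -/

/-- The class of the vertex in row `i` at position `j`. -/
def drumMk (k : ℕ) (i : Fin (k + 1)) (j : Fin (2 * k + 2)) : DrumVertex k :=
  Quotient.mk (oppositeSetoid k) (i, j)

theorem drumMk_eq_iff {k : ℕ} {i i' : Fin (k + 1)} {j j' : Fin (2 * k + 2)} :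
    drumMk k i j = drumMk k i' j' ↔ (i.val = i'.val ∧ j.val = j'.val) ∨
      (i.val + i'.val = k ∧ (j'.val = j.val + (k + 1) ∨ j.val = j'.val + (k + 1))) := by
  refine Quotient.eq.trans ?_
  change ((i, j) = (i', j') ∨ AreOpposite k (i, j) (i', j')) ↔ _
  simp [AreOpposite, Fin.ext_iff]

theorem exists_drumMk_eq {k : ℕ} (v : DrumVertex k) :
    ∃ i j, j.val ≤ k ∧ drumMk k i j = v := by
  induction v using Quotient.inductionOn with
  | h p =>
    obtain ⟨i, j⟩ := p
    by_cases hj : j.val ≤ k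
    · exact ⟨i, j, hj, rfl⟩
    · have := i.2
      have := j.2
      refine ⟨⟨k - i, by omega⟩, ⟨j - (k + 1), by omega⟩, by simp only; omega, ?_⟩
      refine drumMk_eq_iff.2 ?_
      simp only
      omega

instance (k : ℕ) : Finite (DrumVertex k) :=
  inferInstanceAs (Finite (Quotient (oppositeSetoid k)))

theorem fin_sub_val {n : ℕ} (a b : Fin n) :
    (a - b).val = if b.val ≤ a.val then a.val - b.val else n - b.val + a.val := by
  have ha := a.2
  split_ifs with h
  · exact Fin.sub_val_of_le h
  · rw [Fin.val_sub, Nat.mod_eq_of_lt (by omega)]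

theorem cycleGraph_adj_iff_val {n : ℕ} {a b : Fin (n + 2)} :
    (SimpleGraph.cycleGraph (n + 2)).Adj a b ↔ b.val = a.val + 1 ∨ a.val = b.val + 1 ∨
      (a.val = 0 ∧ b.val = n + 1) ∨ (b.val = 0 ∧ a.val = n + 1) := by
  rw [SimpleGraph.cycleGraph_adj', fin_sub_val, fin_sub_val]
  have ha := a.2
  have hb := b.2
  split_ifs <;> omega

/-- The edges of the drum: in row `b`, from position `a` to `a + 1`, and at position `a`, from row
`b` to row `b + 1`. -/
abbrev DrumEdge (k : ℕ) : Type := Fin (k + 1) × Fin (k + 1) ⊕ Fin (k + 1) × Fin k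

/-- The first end of a drum edge. -/
def drumSrc (k : ℕ) : DrumEdge k → DrumVertex k
  | .inl e => drumMk k e.2 ⟨e.1, by omega⟩
  | .inr e => drumMk k e.2.castSucc ⟨e.1, by omega⟩

/-- The second end of a drum edge. -/
def drumTgt (k : ℕ) : DrumEdge k → DrumVertex k
  | .inl e => drumMk k e.2 ⟨e.1 + 1, by omega⟩
  | .inr e => drumMk k e.2.succ ⟨e.1, by omega⟩

theorem drumEdge_injective {k : ℕ} (hk : 2 ≤ k) :
    Function.Injective fun e => s(drumSrc k e, drumTgt k e) := by
  rintro (⟨⟨a, ha⟩, ⟨b, hb⟩⟩ | ⟨⟨a, ha⟩, ⟨b, hb⟩⟩) (⟨⟨c, hc⟩, ⟨d, hd⟩⟩ | ⟨⟨c, hc⟩, ⟨d, hd⟩⟩) h <;>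
  simp only [drumSrc, drumTgt, Sym2.eq_iff, drumMk_eq_iff, Fin.val_castSucc, Fin.val_succ] at h <;>
  simp only [Sum.inl.injEq, Sum.inr.injEq, Prod.mk.injEq, Fin.mk.injEq, reduceCtorEq] <;> omega

theorem drumSrc_ne_drumTgt {k : ℕ} (hk : 2 ≤ k) (e : DrumEdge k) : drumSrc k e ≠ drumTgt k e := by
  rcases e with ⟨⟨a, ha⟩, ⟨b, hb⟩⟩ | ⟨⟨a, ha⟩, ⟨b, hb⟩⟩ <;> intro h <;>
  simp only [drumSrc, drumTgt, drumMk_eq_iff, Fin.val_castSucc, Fin.val_succ] at h <;> omega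

/-- The drum before the identification of opposite vertices. -/
abbrev drumGraph (k : ℕ) : SimpleGraph (Fin (k + 1) × Fin (2 * k + 2)) :=
  SimpleGraph.pathGraph (k + 1) □ SimpleGraph.cycleGraph (2 * k + 2)

theorem drumGraph_adj_iff {k : ℕ} {p q : Fin (k + 1) × Fin (2 * k + 2)} :
    (drumGraph k).Adj p q ↔
      ((p.1.val + 1 = q.1.val ∨ q.1.val + 1 = p.1.val) ∧ p.2.val = q.2.val) ∨
      ((q.2.val = p.2.val + 1 ∨ p.2.val = q.2.val + 1 ∨ (p.2.val = 0 ∧ q.2.val = 2 * k + 1) ∨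
        (q.2.val = 0 ∧ p.2.val = 2 * k + 1)) ∧ p.1.val = q.1.val) := by
  rw [SimpleGraph.boxProd_adj, SimpleGraph.pathGraph_adj, cycleGraph_adj_iff_val, Fin.ext_iff,
    Fin.ext_iff]

/-- `DrumEdge` keeps only the edges starting in columns `0, …, k`. Every other edge is opposite to
one of these. -/
theorem exists_drumEdge_of_adj {k : ℕ} {p q : Fin (k + 1) × Fin (2 * k + 2)}
    (h : (drumGraph k).Adj p q) :
    ∃ e, s(drumSrc k e, drumTgt k e) = s(drumMk k p.1 p.2, drumMk k q.1 q.2) := by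
  rw [drumGraph_adj_iff] at h
  wlog hw : p.1.val + 1 = q.1.val ∨ (p.1.val = q.1.val ∧ (q.2.val = p.2.val + 1 ∨
      (q.2.val = 0 ∧ p.2.val = 2 * k + 1))) generalizing p q
  · obtain ⟨e, he⟩ := this (p := q) (q := p) (by omega) (by omega)
    exact ⟨e, he.trans Sym2.eq_swap⟩
  obtain ⟨⟨i, hi⟩, ⟨j, hj⟩⟩ := p
  obtain ⟨⟨i', hi'⟩, ⟨j', hj'⟩⟩ := q
  simp only at h hw
  by_cases hv : i + 1 = i'
  · by_cases hjk : j ≤ k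
    · refine ⟨.inr (⟨j, by omega⟩, ⟨i, by omega⟩), ?_⟩
      simp only [drumSrc, drumTgt, Sym2.eq_iff, drumMk_eq_iff, Fin.val_castSucc, Fin.val_succ,
        true_and, true_or, and_true]
      omega
    -- Passing to opposite vertices reverses the rows, so the upper end `i'` gives the lower row `k
    -- - i'`.
    · refine ⟨.inr (⟨j - (k + 1), by omega⟩, ⟨k - i', by omega⟩), ?_⟩
      simp only [drumSrc, drumTgt, Sym2.eq_iff, drumMk_eq_iff, Fin.val_castSucc, Fin.val_succ]
      omega
  · by_cases hjk : j ≤ k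
    · refine ⟨.inl (⟨j, by omega⟩, ⟨i, by omega⟩), ?_⟩
      simp only [drumSrc, drumTgt, Sym2.eq_iff, drumMk_eq_iff, true_and]
      omega
    · refine ⟨.inl (⟨j - (k + 1), by omega⟩, ⟨k - i, by omega⟩), ?_⟩
      simp only [drumSrc, drumTgt, Sym2.eq_iff, drumMk_eq_iff]
      omega

theorem exists_adj_of_drumEdge {k : ℕ} (e : DrumEdge k) :
    ∃ p q, (drumGraph k).Adj p q ∧ drumMk k p.1 p.2 = drumSrc k e ∧
      drumMk k q.1 q.2 = drumTgt k e := by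
  rcases e with ⟨a, b⟩ | ⟨a, b⟩
  · refine ⟨(_, _), (_, _), ?_, rfl, rfl⟩
    rw [drumGraph_adj_iff]
    simp
  · refine ⟨(_, _), (_, _), ?_, rfl, rfl⟩
    rw [drumGraph_adj_iff]
    simp

/-- Opposite vertices lie in rows with sum `k > 0`, so nothing is identified within row `0`. -/
theorem drumMk_zero_ne {k : ℕ} (hk : 2 ≤ k) {a b : Fin (2 * k + 2)} (h : a ≠ b) :
    drumMk k 0 a ≠ drumMk k 0 b := by
  rw [Ne, drumMk_eq_iff, Fin.val_zero]
  rw [Ne, Fin.ext_iff] at h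
  omega

theorem drumWith_adj_iff {k : ℕ} (hk : 2 ≤ k) {B : SimpleGraph (Fin (2 * k + 2))}
    {u v : DrumVertex k} : (drumWith k B).Adj u v ↔
      (∃ e, s(drumSrc k e, drumTgt k e) = s(u, v)) ∨
      ∃ a b, B.Adj a b ∧ s(drumMk k 0 a, drumMk k 0 b) = s(u, v) := by
  constructor
  · rintro ⟨-, p, q, h | h, rfl, rfl⟩
    · exact Or.inl (exists_drumEdge_of_adj h)
    · obtain ⟨-, a, b, hab, rfl, rfl⟩ := h
      exact Or.inr ⟨a, b, hab, rfl⟩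
  · rintro (⟨e, he⟩ | ⟨a, b, hab, he⟩)
    · rw [← SimpleGraph.mem_edgeSet, ← he, SimpleGraph.mem_edgeSet]
      obtain ⟨p, q, h, hp, hq⟩ := exists_adj_of_drumEdge e
      exact ⟨drumSrc_ne_drumTgt hk e, p, q, Or.inl h, hp, hq⟩
    · rw [← SimpleGraph.mem_edgeSet, ← he, SimpleGraph.mem_edgeSet]
      exact ⟨drumMk_zero_ne hk hab.ne, (0, a), (0, b),
        Or.inr ⟨fun h => hab.ne (congrArg Prod.snd h), a, b, hab, rfl, rfl⟩, rfl, rfl⟩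

/-! ### Gluing a filling to the drum -/

section Chart

variable {S : Type*} (k : ℕ) (D : ℝ × ℝ → S)

/-- The points drawn for the vertices by a chart of the drum. -/
def drumPoint : DrumVertex k → S :=
  Quotient.lift (fun p : Fin (k + 1) × Fin (2 * k + 2) =>
    if p.2.val ≤ k then D (p.2.val, p.1.val) else D (p.2.val - (k + 1), k - p.1.val)) <| by
    have key (p q : Fin (k + 1) × Fin (2 * k + 2)) (h : p.1.val + q.1.val = k)
        (h' : q.2.val = p.2.val + (k + 1)) :
        (if p.2.val ≤ k then D (p.2.val, p.1.val) else D (p.2.val - (k + 1), k - p.1.val)) =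
        if q.2.val ≤ k then D (q.2.val, q.1.val) else D (q.2.val - (k + 1), k - q.1.val) := by
      have := q.2.2
      rw [if_pos (by omega), if_neg (by omega)]
      congr 2
      · rw [h']
        push_cast
        ring
      · have : (p.1.val : ℝ) + q.1.val = k := by exact_mod_cast h
        linarith
    rintro p q (rfl | ⟨h, h' | h'⟩)
    · rfl
    · exact key p q h h'
    · exact (key q p (by omega) h').symm

theorem drumPoint_mk_of_le {i : Fin (k + 1)} {j : Fin (2 * k + 2)} (h : j.val ≤ k) :
    drumPoint k D (drumMk k i j) = D (j.val, i.val) :=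
  if_pos h

theorem drumPoint_mk_of_lt {i : Fin (k + 1)} {j : Fin (2 * k + 2)} (h : k < j.val) :
    drumPoint k D (drumMk k i j) = D (j.val - (k + 1), k - i.val) :=
  if_neg h.not_ge

/-- The arcs drawn for the drum edges by a chart. -/
def drumArc : DrumEdge k → ℝ → S
  | .inl e, t => D (e.1.val + t, e.2.val)
  | .inr e, t => D (e.1.val, e.2.val + t)

/-- The squares between two consecutive rows. -/
def drumFace (f : Fin (k + 1) × Fin k) (z : ℝ × ℝ) : S := D (f.1.val + z.1, f.2.val + z.2)

end Chart

/-- A chart of the drum in a space `S`, together with a square decomposition of the rest of `S`,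
whose edges are those of `B` on the bottom row that are not drum edges. -/
structure DrumFilling (k : ℕ) (B : SimpleGraph (Fin (2 * k + 2))) (S : Type*) [TopologicalSpace S]
    (E F : Type*) where
  chart : ℝ × ℝ → S
  chart_continuous : Continuous chart
  chart_glue (y : ℝ) : y ∈ Set.Icc (0 : ℝ) k → chart (k + 1, y) = chart (0, k - y)
  chart_inj (x y x' y' : ℝ) : x ∈ Set.Icc (0 : ℝ) (k + 1) → y ∈ Set.Icc (0 : ℝ) k →
    x' ∈ Set.Icc (0 : ℝ) (k + 1) → y' ∈ Set.Icc (0 : ℝ) k → chart (x, y) = chart (x', y') →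
    (x = x' ∧ y = y') ∨ (x = 0 ∧ x' = k + 1) ∨ (x = k + 1 ∧ x' = 0)
  src : E → DrumVertex k
  tgt : E → DrumVertex k
  arc : E → ℝ → S
  face : F → ℝ × ℝ → S
  arc_continuous (e : E) : Continuous (arc e)
  face_continuous (f : F) : Continuous (face f)
  arc_zero (e : E) : arc e 0 = drumPoint k chart (src e)
  arc_one (e : E) : arc e 1 = drumPoint k chart (tgt e)
  exists_adj (e : E) : ∃ a b, B.Adj a b ∧ s(drumMk k 0 a, drumMk k 0 b) = s(src e, tgt e)
  exists_edge (a b : Fin (2 * k + 2)) : B.Adj a b →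
    (drumGraph k).Adj (0, a) (0, b) ∨ ∃ e, s(src e, tgt e) = s(drumMk k 0 a, drumMk k 0 b)
  edge_injective : Function.Injective fun e => s(src e, tgt e)
  edge_ne (d : DrumEdge k) (e : E) : s(drumSrc k d, drumTgt k d) ≠ s(src e, tgt e)
  side_bottom (f : F) : IsSideOf (Sum.elim (drumArc k chart) arc) fun t => face f (t, 0)
  side_right (f : F) : IsSideOf (Sum.elim (drumArc k chart) arc) fun t => face f (1, t)
  side_top (f : F) : IsSideOf (Sum.elim (drumArc k chart) arc) fun t => face f (t, 1)
  side_left (f : F) : IsSideOf (Sum.elim (drumArc k chart) arc) fun t => face f (0, t)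
  face_injOn (f : F) : Set.InjOn (face f) (Set.Icc 0 1 ×ˢ Set.Icc 0 1)
  arc_ne_chart (e : E) (t x y : ℝ) : t ∈ Set.Ioo (0 : ℝ) 1 → x ∈ Set.Icc (0 : ℝ) (k + 1) →
    y ∈ Set.Icc (0 : ℝ) k → arc e t ≠ chart (x, y)
  face_ne_chart (f : F) (z : ℝ × ℝ) (x y : ℝ) : z ∈ Set.Ioo (0 : ℝ) 1 ×ˢ Set.Ioo (0 : ℝ) 1 →
    x ∈ Set.Icc (0 : ℝ) (k + 1) → y ∈ Set.Icc (0 : ℝ) k → face f z ≠ chart (x, y)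
  face_ne_arc (f : F) (z : ℝ × ℝ) (e : E) (t : ℝ) : z ∈ Set.Ioo (0 : ℝ) 1 ×ˢ Set.Ioo (0 : ℝ) 1 →
    t ∈ Set.Ioo (0 : ℝ) 1 → face f z ≠ arc e t
  arc_inj (e e' : E) (t t' : ℝ) : t ∈ Set.Ioo (0 : ℝ) 1 → t' ∈ Set.Ioo (0 : ℝ) 1 →
    arc e t = arc e' t' → e = e' ∧ t = t'
  face_inj (f f' : F) (z z' : ℝ × ℝ) : z ∈ Set.Ioo (0 : ℝ) 1 ×ˢ Set.Ioo (0 : ℝ) 1 →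
    z' ∈ Set.Ioo (0 : ℝ) 1 ×ˢ Set.Ioo (0 : ℝ) 1 → face f z = face f' z' → f = f'
  cover (p : S) : (∃ x ∈ Set.Icc (0 : ℝ) (k + 1), ∃ y ∈ Set.Icc (0 : ℝ) k, chart (x, y) = p) ∨
    (∃ e, ∃ t ∈ Set.Ioo (0 : ℝ) 1, arc e t = p) ∨
    ∃ f, ∃ z ∈ Set.Ioo (0 : ℝ) 1 ×ˢ Set.Ioo (0 : ℝ) 1, face f z = p

theorem natCast_add_inj {a b : ℕ} {s t : ℝ} (hs : s ∈ Set.Ico (0 : ℝ) 1)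
    (ht : t ∈ Set.Ico (0 : ℝ) 1) (h : (a : ℝ) + s = b + t) : a = b ∧ s = t := by
  have h1 : a = b := by
    have h2 : (a : ℝ) < b + 1 := by linarith [hs.1, ht.2]
    have h3 : (b : ℝ) < a + 1 := by linarith [hs.2, ht.1]
    have h2' : a < b + 1 := by exact_mod_cast h2
    have h3' : b < a + 1 := by exact_mod_cast h3
    omega
  subst h1
  exact ⟨rfl, by linarith⟩

theorem exists_natCast_add {x : ℝ} (h : 0 ≤ x) :
    ∃ (a : ℕ) (s : ℝ), s ∈ Set.Ico (0 : ℝ) 1 ∧ x = a + s :=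
  ⟨⌊x⌋₊, x - ⌊x⌋₊, ⟨by linarith [Nat.floor_le h], by linarith [Nat.lt_floor_add_one x]⟩, by ring⟩

namespace DrumFilling

variable {k : ℕ} {B : SimpleGraph (Fin (2 * k + 2))} {S : Type*} [TopologicalSpace S]
  {E F : Type*} (X : DrumFilling k B S E F)

/-- Half-open cells stay strictly left of the seam `x = k + 1`, so the seam alternatives of
`chart_inj` are void and integer and fractional parts can be compared. The disjointness of vertices,
open edges and open squares of the drum all comes from this. -/
theorem cell_inj {a b a' b' : ℕ} {s t s' t' : ℝ} (ha : a ≤ k) (ha' : a' ≤ k)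
    (hs : s ∈ Set.Ico (0 : ℝ) 1) (ht : t ∈ Set.Ico (0 : ℝ) 1) (hs' : s' ∈ Set.Ico (0 : ℝ) 1)
    (ht' : t' ∈ Set.Ico (0 : ℝ) 1) (hb : (b : ℝ) + t ≤ k) (hb' : (b' : ℝ) + t' ≤ k)
    (h : X.chart (a + s, b + t) = X.chart (a' + s', b' + t')) :
    a = a' ∧ b = b' ∧ s = s' ∧ t = t' := by
  have hR : (a : ℝ) ≤ k := by exact_mod_cast ha
  have hR' : (a' : ℝ) ≤ k := by exact_mod_cast ha'
  have h1 := X.chart_inj _ _ _ _ ⟨by linarith [hs.1, (Nat.cast_nonneg a : (0 : ℝ) ≤ a)],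
    by linarith [hs.2]⟩ ⟨by linarith [ht.1, (Nat.cast_nonneg b : (0 : ℝ) ≤ b)], hb⟩
    ⟨by linarith [hs'.1, (Nat.cast_nonneg a' : (0 : ℝ) ≤ a')], by linarith [hs'.2]⟩
    ⟨by linarith [ht'.1, (Nat.cast_nonneg b' : (0 : ℝ) ≤ b')], hb'⟩ h
  rcases h1 with ⟨h1, h2⟩ | ⟨h1, h2⟩ | ⟨h1, h2⟩
  · obtain ⟨h3, h4⟩ := natCast_add_inj hs hs' h1
    obtain ⟨h5, h6⟩ := natCast_add_inj ht ht' h2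
    exact ⟨h3, h5, h4, h6⟩
  · linarith [hs'.2]
  · linarith [hs.2]

theorem exists_point_eq (v : DrumVertex k) : ∃ a b : ℕ, a ≤ k ∧ b ≤ k ∧
    drumPoint k X.chart v = X.chart (a + 0, b + 0) := by
  obtain ⟨i, j, hj, rfl⟩ := exists_drumMk_eq v
  exact ⟨j, i, hj, by omega, by rw [drumPoint_mk_of_le _ _ hj, add_zero, add_zero]⟩

theorem exists_arc_eq (e : DrumEdge k) {t : ℝ} (ht : t ∈ Set.Ioo (0 : ℝ) 1) :
    ∃ (a b : ℕ) (s t' : ℝ), a ≤ k ∧ (b : ℝ) + t' ≤ k ∧ s ∈ Set.Ico (0 : ℝ) 1 ∧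
      t' ∈ Set.Ico (0 : ℝ) 1 ∧ (0 < s ∨ 0 < t') ∧ (s = 0 ∨ t' = 0) ∧
      drumArc k X.chart e t = X.chart (a + s, b + t') := by
  rcases e with ⟨a, b⟩ | ⟨a, b⟩
  · refine ⟨a, b, t, 0, by omega, ?_, Set.Ioo_subset_Ico_self ht, ⟨le_rfl, one_pos⟩,
      Or.inl ht.1, Or.inr rfl, by simp [drumArc]⟩
    rw [add_zero]
    exact_mod_cast Nat.lt_succ_iff.1 b.2
  · refine ⟨a, b, 0, t, by omega, ?_, ⟨le_rfl, one_pos⟩, Set.Ioo_subset_Ico_self ht,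
      Or.inr ht.1, Or.inl rfl, by simp [drumArc]⟩
    have : (b : ℝ) + 1 ≤ k := by exact_mod_cast b.2
    linarith [ht.2]

theorem drumArc_inj {e e' : DrumEdge k} {t t' : ℝ} (ht : t ∈ Set.Ioo (0 : ℝ) 1)
    (ht' : t' ∈ Set.Ioo (0 : ℝ) 1) (h : drumArc k X.chart e t = drumArc k X.chart e' t') :
    e = e' ∧ t = t' := by
  have z : (0 : ℝ) ∈ Set.Ico (0 : ℝ) 1 := ⟨le_rfl, one_pos⟩
  have ho := Set.Ioo_subset_Ico_self ht
  have ho' := Set.Ioo_subset_Ico_self ht'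
  have cast1 (b : Fin (k + 1)) : (b.val : ℝ) + 0 ≤ k := by
    rw [add_zero]
    exact_mod_cast Nat.lt_succ_iff.1 b.2
  have cast2 (b : Fin k) {t : ℝ} (ht : t ∈ Set.Ioo (0 : ℝ) 1) : (b.val : ℝ) + t ≤ k := by
    have : (b : ℝ) + 1 ≤ k := by exact_mod_cast b.2
    linarith [ht.2]
  rcases e with ⟨a, b⟩ | ⟨a, b⟩ <;> rcases e' with ⟨c, d⟩ | ⟨c, d⟩
  · obtain ⟨h1, h2, h3, -⟩ := X.cell_inj (a := a) (b := b) (a' := c) (b' := d) (s := t) (s' := t')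
      (t := 0) (t' := 0) (by omega) (by omega) ho z ho' z (cast1 b) (cast1 d)
      (by simpa [drumArc] using h)
    exact ⟨by rw [Fin.ext h1, Fin.ext h2], h3⟩
  · obtain ⟨-, -, h3, -⟩ := X.cell_inj (a := a) (b := b) (a' := c) (b' := d) (s := t) (s' := 0)
      (t := 0) (t' := t') (by omega) (by omega) ho z z ho' (cast1 b) (cast2 d ht')
      (by simpa [drumArc] using h)
    exact absurd h3 ht.1.ne'
  · obtain ⟨-, -, h3, -⟩ := X.cell_inj (a := a) (b := b) (a' := c) (b' := d) (s := 0) (s' := t')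
      (t := t) (t' := 0) (by omega) (by omega) z ho ho' z (cast2 b ht) (cast1 d)
      (by simpa [drumArc] using h)
    exact absurd h3 ht'.1.ne
  · obtain ⟨h1, h2, -, h3⟩ := X.cell_inj (a := a) (b := b) (a' := c) (b' := d) (s := 0) (s' := 0)
      (t := t) (t' := t') (by omega) (by omega) z ho z ho' (cast2 b ht) (cast2 d ht')
      (by simpa [drumArc] using h)
    exact ⟨by rw [Fin.ext h1, Fin.ext h2], h3⟩

theorem face_row_le (b : Fin k) {t : ℝ} (ht : t ≤ 1) : (b.val : ℝ) + t ≤ k := by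
  have : (b : ℝ) + 1 ≤ k := by exact_mod_cast b.2
  linarith

theorem arc_mem_chart (e : DrumEdge k) {t : ℝ} (ht : t ∈ Set.Ioo (0 : ℝ) 1) :
    ∃ x ∈ Set.Icc (0 : ℝ) (k + 1), ∃ y ∈ Set.Icc (0 : ℝ) k,
      drumArc k X.chart e t = X.chart (x, y) := by
  obtain ⟨a, b, s, t', ha, hb, hs, ht', -, -, h⟩ := X.exists_arc_eq e ht
  have ha' : (a : ℝ) ≤ k := by exact_mod_cast ha
  exact ⟨_, ⟨add_nonneg a.cast_nonneg hs.1, by linarith [hs.2]⟩, _,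
    ⟨add_nonneg b.cast_nonneg ht'.1, hb⟩, h⟩

theorem point_mem_chart (v : DrumVertex k) :
    ∃ x ∈ Set.Icc (0 : ℝ) (k + 1), ∃ y ∈ Set.Icc (0 : ℝ) k,
      drumPoint k X.chart v = X.chart (x, y) := by
  obtain ⟨a, b, ha, hb, h⟩ := X.exists_point_eq v
  have ha' : (a : ℝ) ≤ k := by exact_mod_cast ha
  have hb' : (b : ℝ) ≤ k := by exact_mod_cast hb
  exact ⟨_, ⟨by simp, by linarith⟩, _, ⟨by simp, by linarith⟩, h⟩

theorem face_mem_chart (f : Fin (k + 1) × Fin k) {z : ℝ × ℝ}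
    (hz : z ∈ Set.Ioo (0 : ℝ) 1 ×ˢ Set.Ioo (0 : ℝ) 1) :
    ∃ x ∈ Set.Icc (0 : ℝ) (k + 1), ∃ y ∈ Set.Icc (0 : ℝ) k,
      drumFace k X.chart f z = X.chart (x, y) := by
  have ha' : (f.1.val : ℝ) ≤ k := by exact_mod_cast Nat.lt_succ_iff.1 f.1.2
  exact ⟨_, ⟨add_nonneg (Nat.cast_nonneg _) hz.1.1.le, by linarith [hz.1.2]⟩, _,
    ⟨add_nonneg (Nat.cast_nonneg _) hz.2.1.le, face_row_le _ hz.2.2.le⟩, rfl⟩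

theorem drumPoint_injective : Function.Injective (drumPoint k X.chart) := by
  intro u v h
  obtain ⟨i, j, hj, rfl⟩ := exists_drumMk_eq u
  obtain ⟨i', j', hj', rfl⟩ := exists_drumMk_eq v
  rw [drumPoint_mk_of_le _ _ hj, drumPoint_mk_of_le _ _ hj'] at h
  have z : (0 : ℝ) ∈ Set.Ico (0 : ℝ) 1 := ⟨le_rfl, one_pos⟩
  have hi : (i.val : ℝ) + 0 ≤ k := by
    rw [add_zero]
    exact_mod_cast Nat.lt_succ_iff.1 i.2
  have hi' : (i'.val : ℝ) + 0 ≤ k := by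
    rw [add_zero]
    exact_mod_cast Nat.lt_succ_iff.1 i'.2
  obtain ⟨h1, h2, -⟩ := X.cell_inj hj hj' z z z z hi hi' (by simpa using h)
  rw [Fin.ext h1, Fin.ext h2]

theorem drumArc_ne_drumPoint (e : DrumEdge k) {t : ℝ} (ht : t ∈ Set.Ioo (0 : ℝ) 1)
    (v : DrumVertex k) : drumArc k X.chart e t ≠ drumPoint k X.chart v := by
  intro h
  obtain ⟨a, b, s, t', ha, hb, hs, ht', h0, -, h1⟩ := X.exists_arc_eq e ht
  obtain ⟨c, d, hc, hd, h2⟩ := X.exists_point_eq v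
  have z : (0 : ℝ) ∈ Set.Ico (0 : ℝ) 1 := ⟨le_rfl, one_pos⟩
  have hd' : (d : ℝ) ≤ k := by exact_mod_cast hd
  obtain ⟨-, -, h3, h4⟩ := X.cell_inj ha hc hs ht' z z hb (by linarith) (h1.symm.trans (h.trans h2))
  rcases h0 with h0 | h0 <;> linarith

theorem drumFace_ne_drumPoint (f : Fin (k + 1) × Fin k) {z : ℝ × ℝ}
    (hz : z ∈ Set.Ioo (0 : ℝ) 1 ×ˢ Set.Ioo (0 : ℝ) 1)
    (v : DrumVertex k) : drumFace k X.chart f z ≠ drumPoint k X.chart v := by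
  intro h
  obtain ⟨c, d, hc, hd, h2⟩ := X.exists_point_eq v
  have z' : (0 : ℝ) ∈ Set.Ico (0 : ℝ) 1 := ⟨le_rfl, one_pos⟩
  have hd' : (d : ℝ) ≤ k := by exact_mod_cast hd
  obtain ⟨-, -, h3, -⟩ := X.cell_inj (Nat.lt_succ_iff.1 f.1.2) hc (Set.Ioo_subset_Ico_self hz.1)
    (Set.Ioo_subset_Ico_self hz.2) z' z' (face_row_le _ hz.2.2.le) (by linarith) (h.trans h2)
  exact hz.1.1.ne' h3

theorem drumFace_ne_drumArc (f : Fin (k + 1) × Fin k) {z : ℝ × ℝ}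
    (hz : z ∈ Set.Ioo (0 : ℝ) 1 ×ˢ Set.Ioo (0 : ℝ) 1) (e : DrumEdge k) {t : ℝ}
    (ht : t ∈ Set.Ioo (0 : ℝ) 1) : drumFace k X.chart f z ≠ drumArc k X.chart e t := by
  intro h
  obtain ⟨a, b, s, t', ha, hb, hs, ht', -, h0, h1⟩ := X.exists_arc_eq e ht
  obtain ⟨-, -, h3, h4⟩ := X.cell_inj (Nat.lt_succ_iff.1 f.1.2) ha (Set.Ioo_subset_Ico_self hz.1)
    (Set.Ioo_subset_Ico_self hz.2) hs ht' (face_row_le _ hz.2.2.le) hb (h.trans h1)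
  rcases h0 with h0 | h0
  · exact hz.1.1.ne' (h3.trans h0)
  · exact hz.2.1.ne' (h4.trans h0)

theorem drumFace_inj (f f' : Fin (k + 1) × Fin k) {z z' : ℝ × ℝ}
    (hz : z ∈ Set.Ioo (0 : ℝ) 1 ×ˢ Set.Ioo (0 : ℝ) 1)
    (hz' : z' ∈ Set.Ioo (0 : ℝ) 1 ×ˢ Set.Ioo (0 : ℝ) 1)
    (h : drumFace k X.chart f z = drumFace k X.chart f' z') : f = f' := by
  obtain ⟨h1, h2, -, -⟩ := X.cell_inj (Nat.lt_succ_iff.1 f.1.2) (Nat.lt_succ_iff.1 f'.1.2)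
    (Set.Ioo_subset_Ico_self hz.1) (Set.Ioo_subset_Ico_self hz.2) (Set.Ioo_subset_Ico_self hz'.1)
    (Set.Ioo_subset_Ico_self hz'.2) (face_row_le _ hz.2.2.le) (face_row_le _ hz'.2.2.le) h
  exact Prod.ext (Fin.ext h1) (Fin.ext h2)

/-- A square has width `1 < k + 1`, so it cannot meet both ends of the seam. -/
theorem drumFace_injOn (hk : 2 ≤ k) (f : Fin (k + 1) × Fin k) :
    Set.InjOn (drumFace k X.chart f) (Set.Icc 0 1 ×ˢ Set.Icc 0 1) := by
  rintro ⟨s, t⟩ ⟨hs, ht⟩ ⟨s', t'⟩ ⟨hs', ht'⟩ h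
  simp only at hs ht hs' ht'
  have hkR : (2 : ℝ) ≤ k := by exact_mod_cast hk
  have ha : (f.1.val : ℝ) ≤ k := by exact_mod_cast Nat.lt_succ_iff.1 f.1.2
  have ha0 : (0 : ℝ) ≤ f.1.val := Nat.cast_nonneg _
  have hb0 : (0 : ℝ) ≤ f.2.val := Nat.cast_nonneg _
  rcases X.chart_inj _ _ _ _ ⟨by linarith [hs.1], by linarith [hs.2]⟩
    ⟨by linarith [ht.1], face_row_le _ ht.2⟩ ⟨by linarith [hs'.1], by linarith [hs'.2]⟩
    ⟨by linarith [ht'.1], face_row_le _ ht'.2⟩ h with ⟨h1, h2⟩ | ⟨h1, h2⟩ | ⟨h1, h2⟩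
  · simp only at h1 h2
    exact Prod.ext (by simp only; linarith) (by simp only; linarith)
  · simp only at h1 h2
    linarith [hs.1, hs.2, hs'.1, hs'.2]
  · simp only at h1 h2
    linarith [hs.1, hs.2, hs'.1, hs'.2]

theorem drumFace_sides (f : Fin (k + 1) × Fin k) :
    IsSideOf (drumArc k X.chart) (fun t => drumFace k X.chart f (t, 0)) ∧
    IsSideOf (drumArc k X.chart) (fun t => drumFace k X.chart f (1, t)) ∧
    IsSideOf (drumArc k X.chart) (fun t => drumFace k X.chart f (t, 1)) ∧
    IsSideOf (drumArc k X.chart) (fun t => drumFace k X.chart f (0, t)) := by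
  obtain ⟨⟨a, ha⟩, ⟨b, hb⟩⟩ := f
  refine ⟨⟨.inl (⟨a, ha⟩, ⟨b, by omega⟩), Or.inl fun t _ => ?_⟩, ?_,
    ⟨.inl (⟨a, ha⟩, ⟨b + 1, by omega⟩), Or.inl fun t _ => ?_⟩,
    ⟨.inr (⟨a, ha⟩, ⟨b, hb⟩), Or.inl fun t _ => ?_⟩⟩
  · simp [drumFace, drumArc]
  -- In the last column the right side lies on the seam: it is glued to column `0` with heights
  -- reversed, so rows `b, b + 1` become `k - b, k - b - 1`.
  · rcases (Nat.lt_succ_iff.1 ha).eq_or_lt with rfl | h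
    · refine ⟨.inr (⟨0, by omega⟩, ⟨a - b - 1, by omega⟩), Or.inr fun t ht => ?_⟩
      have hbR : (b : ℝ) + 1 ≤ a := by exact_mod_cast hb
      have hb0 : (0 : ℝ) ≤ b := b.cast_nonneg
      simp only [drumFace, drumArc]
      rw [X.chart_glue _ ⟨by linarith [ht.1], by linarith [ht.2]⟩]
      congr 2
      · simp
      · rw [Nat.cast_sub (by omega), Nat.cast_sub (by omega)]
        push_cast
        ring
    · exact ⟨.inr (⟨a + 1, by omega⟩, ⟨b, hb⟩), Or.inl fun t _ => by simp [drumFace, drumArc]⟩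
  · simp [drumFace, drumArc]
  · simp [drumFace, drumArc]

theorem chart_cover {x y : ℝ} (hx : x ∈ Set.Icc (0 : ℝ) (k + 1)) (hy : y ∈ Set.Icc (0 : ℝ) k) :
    (∃ v, drumPoint k X.chart v = X.chart (x, y)) ∨
    (∃ e, ∃ t ∈ Set.Ioo (0 : ℝ) 1, drumArc k X.chart e t = X.chart (x, y)) ∨
    ∃ f, ∃ z ∈ Set.Ioo (0 : ℝ) 1 ×ˢ Set.Ioo (0 : ℝ) 1,
      drumFace k X.chart f z = X.chart (x, y) := by
  -- A point on the right end of the seam is replaced by its copy on the left end.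
  wlog hx' : x < k + 1 generalizing x y
  · have hx1 : x = k + 1 := le_antisymm hx.2 (not_lt.1 hx')
    subst hx1
    rw [X.chart_glue _ hy]
    exact this ⟨le_rfl, by linarith [(Nat.cast_nonneg k : (0 : ℝ) ≤ k)]⟩
      ⟨by linarith [hy.2], by linarith [hy.1]⟩ (by linarith [(Nat.cast_nonneg k : (0 : ℝ) ≤ k)])
  obtain ⟨a, s, hs, rfl⟩ := exists_natCast_add hx.1
  obtain ⟨b, t, ht, rfl⟩ := exists_natCast_add hy.1
  have ha : a < k + 1 := by
    have : (a : ℝ) < k + 1 := by linarith [hs.1]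
    exact_mod_cast this
  have hb : b < k + 1 := by
    have : (b : ℝ) < k + 1 := by linarith [ht.1, hy.2]
    exact_mod_cast this
  have hb' : 0 < t → b < k := fun h => by
    have : (b : ℝ) < k := by linarith [hy.2]
    exact_mod_cast this
  rcases hs.1.eq_or_lt with rfl | hs0
  · rcases ht.1.eq_or_lt with rfl | ht0
    · refine Or.inl ⟨drumMk k ⟨b, hb⟩ ⟨a, by omega⟩, ?_⟩
      rw [drumPoint_mk_of_le _ _ (by simp only; omega)]
      simp
    · exact Or.inr (Or.inl ⟨.inr (⟨a, ha⟩, ⟨b, hb' ht0⟩), t, ⟨ht0, ht.2⟩, by simp [drumArc]⟩)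
  · rcases ht.1.eq_or_lt with rfl | ht0
    · exact Or.inr (Or.inl ⟨.inl (⟨a, ha⟩, ⟨b, hb⟩), s, ⟨hs0, hs.2⟩, by simp [drumArc]⟩)
    · exact Or.inr (Or.inr ⟨(⟨a, ha⟩, ⟨b, hb' ht0⟩), (s, t), ⟨⟨hs0, hs.2⟩, ⟨ht0, ht.2⟩⟩, rfl⟩)

theorem isSideOf_inl {g : ℝ → S} (h : IsSideOf (drumArc k X.chart) g) :
    IsSideOf (Sum.elim (drumArc k X.chart) X.arc) g := by
  obtain ⟨e, he⟩ := h
  exact ⟨.inl e, he⟩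

theorem drumPoint_drumTgt (e : DrumEdge k) :
    drumArc k X.chart e 1 = drumPoint k X.chart (drumTgt k e) := by
  rcases e with ⟨a, b⟩ | ⟨a, b⟩
  · by_cases h : a.val + 1 ≤ k
    · simp only [drumArc, drumTgt]
      rw [drumPoint_mk_of_le _ _ (by exact h)]
      simp
    · have ha : a.val = k := by omega
      have hb : (b.val : ℝ) ≤ k := by exact_mod_cast Nat.lt_succ_iff.1 b.2
      simp only [drumArc, drumTgt]
      rw [drumPoint_mk_of_lt _ _ (by simp only; omega)]
      simp only [ha]
      rw [X.chart_glue _ ⟨by simp, hb⟩]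
      simp
  · simp only [drumArc, drumTgt]
    rw [drumPoint_mk_of_le _ _ (by simp only; omega)]
    simp

theorem drumPoint_drumSrc (e : DrumEdge k) :
    drumArc k X.chart e 0 = drumPoint k X.chart (drumSrc k e) := by
  rcases e with ⟨a, b⟩ | ⟨a, b⟩ <;> simp only [drumArc, drumSrc] <;>
    rw [drumPoint_mk_of_le _ _ (by simp only; omega)] <;> simp

theorem drumArc_continuous (e : DrumEdge k) : Continuous (drumArc k X.chart e) := by
  rcases e with e | e <;> exact X.chart_continuous.comp (by fun_prop)

/-- The square decomposition consisting of the drum and its filling. -/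
def squareDecomposition (hk : 2 ≤ k) :
    SquareDecomposition (drumWith k B) S (DrumEdge k ⊕ E) (Fin (k + 1) × Fin k ⊕ F) where
  point := drumPoint k X.chart
  src := Sum.elim (drumSrc k) X.src
  tgt := Sum.elim (drumTgt k) X.tgt
  arc := Sum.elim (drumArc k X.chart) X.arc
  face := Sum.elim (drumFace k X.chart) X.face
  arc_continuous e := by
    rcases e with e | e
    · exact X.drumArc_continuous e
    · exact X.arc_continuous e
  face_continuous f := by
    rcases f with f | f
    · exact X.chart_continuous.comp (by fun_prop)
    · exact X.face_continuous f
  arc_zero e := by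
    rcases e with e | e
    · exact X.drumPoint_drumSrc e
    · exact X.arc_zero e
  arc_one e := by
    rcases e with e | e
    · exact X.drumPoint_drumTgt e
    · exact X.arc_one e
  adj_iff u v := by
    rw [drumWith_adj_iff hk]
    constructor
    · rintro (⟨e, he⟩ | ⟨a, b, hab, he⟩)
      · exact ⟨.inl e, he⟩
      · rcases X.exists_edge a b hab with h | ⟨e, he'⟩
        · obtain ⟨e, he'⟩ := exists_drumEdge_of_adj h
          exact ⟨.inl e, he'.trans he⟩
        · exact ⟨.inr e, he'.trans he⟩
    · rintro ⟨e | e, he⟩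
      · exact Or.inl ⟨e, he⟩
      · obtain ⟨a, b, hab, h⟩ := X.exists_adj e
        exact Or.inr ⟨a, b, hab, h.trans he⟩
  edge_injective := by
    rintro (e | e) (e' | e') h
    · exact congrArg _ (drumEdge_injective hk h)
    · exact absurd h (X.edge_ne e e')
    · exact absurd h.symm (X.edge_ne e' e)
    · exact congrArg _ (X.edge_injective h)
  side_bottom f := by
    rcases f with f | f
    · exact X.isSideOf_inl (X.drumFace_sides f).1
    · exact X.side_bottom f
  side_right f := by
    rcases f with f | f
    · exact X.isSideOf_inl (X.drumFace_sides f).2.1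
    · exact X.side_right f
  side_top f := by
    rcases f with f | f
    · exact X.isSideOf_inl (X.drumFace_sides f).2.2.1
    · exact X.side_top f
  side_left f := by
    rcases f with f | f
    · exact X.isSideOf_inl (X.drumFace_sides f).2.2.2
    · exact X.side_left f
  face_injOn f := by
    rcases f with f | f
    · exact X.drumFace_injOn hk f
    · exact X.face_injOn f
  point_injective := X.drumPoint_injective
  arc_ne_point e t v ht := by
    rcases e with e | e
    · exact X.drumArc_ne_drumPoint e ht v
    · obtain ⟨x, hx, y, hy, h⟩ := X.point_mem_chart v
      rw [h]
      exact X.arc_ne_chart e t x y ht hx hy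
  face_ne_point f z v hz := by
    rcases f with f | f
    · exact X.drumFace_ne_drumPoint f hz v
    · obtain ⟨x, hx, y, hy, h⟩ := X.point_mem_chart v
      rw [h]
      exact X.face_ne_chart f z x y hz hx hy
  face_ne_arc f z e t hz ht := by
    rcases f with f | f <;> rcases e with e | e
    · exact X.drumFace_ne_drumArc f hz e ht
    · obtain ⟨x, hx, y, hy, h⟩ := X.face_mem_chart f hz
      simp only [Sum.elim_inl, h]
      exact (X.arc_ne_chart e t x y ht hx hy).symm
    · obtain ⟨x, hx, y, hy, h⟩ := X.arc_mem_chart e ht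
      simp only [Sum.elim_inl, h]
      exact X.face_ne_chart f z x y hz hx hy
    · exact X.face_ne_arc f z e t hz ht
  arc_inj e e' t t' ht ht' h := by
    rcases e with e | e <;> rcases e' with e' | e'
    · obtain ⟨rfl, h2⟩ := X.drumArc_inj ht ht' h
      exact ⟨rfl, h2⟩
    · obtain ⟨x, hx, y, hy, h'⟩ := X.arc_mem_chart e ht
      exact absurd (h.symm.trans h') (X.arc_ne_chart e' t' x y ht' hx hy)
    · obtain ⟨x, hx, y, hy, h'⟩ := X.arc_mem_chart e' ht'
      exact absurd (h.trans h') (X.arc_ne_chart e t x y ht hx hy)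
    · obtain ⟨rfl, h2⟩ := X.arc_inj _ _ _ _ ht ht' h
      exact ⟨rfl, h2⟩
  face_inj f f' z z' hz hz' h := by
    rcases f with f | f <;> rcases f' with f' | f'
    · exact congrArg _ (X.drumFace_inj f f' hz hz' h)
    · obtain ⟨x, hx, y, hy, h'⟩ := X.face_mem_chart f hz
      exact absurd (h.symm.trans h') (X.face_ne_chart f' z' x y hz' hx hy)
    · obtain ⟨x, hx, y, hy, h'⟩ := X.face_mem_chart f' hz'
      exact absurd (h.trans h') (X.face_ne_chart f z x y hz hx hy)
    · exact congrArg _ (X.face_inj f f' z z' hz hz' h)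
  cover p := by
    rcases X.cover p with ⟨x, hx, y, hy, rfl⟩ | ⟨e, t, ht, rfl⟩ | ⟨f, z, hz, rfl⟩
    · rcases X.chart_cover hx hy with h | ⟨e, h⟩ | ⟨f, h⟩
      · exact Or.inl h
      · exact Or.inr (Or.inl ⟨.inl e, h⟩)
      · exact Or.inr (Or.inr ⟨.inl f, h⟩)
    · exact Or.inr (Or.inl ⟨.inr e, t, ht, rfl⟩)
    · exact Or.inr (Or.inr ⟨.inr f, z, hz, rfl⟩)

theorem quadrangulates [T2Space S] [Finite E] [Finite F] (hk : 2 ≤ k)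
    (X : DrumFilling k B S E F) : Quadrangulates (drumWith k B) S :=
  (X.squareDecomposition hk).quadrangulates

end DrumFilling

/-! ### The Klein bottle -/

/-- Real invariants separating the points of the Klein bottle. -/
noncomputable def kleinInvariant (p : ℝ × ℝ) : ℂ × ℝ × ℂ :=
  (Complex.exp (p.1 * (2 * Real.pi * Complex.I)), Real.cos (2 * Real.pi * p.2),
    Complex.exp (p.1 * (Real.pi * Complex.I)) * (Real.sin (2 * Real.pi * p.2) : ℝ))

theorem exp_add_int_mul_pi_mul_I (x : ℝ) (m : ℤ) :
    Complex.exp ((x + m : ℝ) * (Real.pi * Complex.I)) =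
      (-1) ^ m * Complex.exp (x * (Real.pi * Complex.I)) := by
  have : ((x + m : ℝ) : ℂ) * (Real.pi * Complex.I) =
      m * (Real.pi * Complex.I) + x * (Real.pi * Complex.I) := by
    push_cast
    ring
  rw [this, Complex.exp_add, Complex.exp_int_mul, Complex.exp_pi_mul_I]

theorem neg_one_zpow_cases (m : ℤ) : (-1 : ℝ) ^ m = 1 ∧ (-1 : ℂ) ^ m = 1 ∨
    (-1 : ℝ) ^ m = -1 ∧ (-1 : ℂ) ^ m = -1 := by
  rcases Int.even_or_odd m with h | h
  · exact Or.inl ⟨h.neg_one_zpow, h.neg_one_zpow⟩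
  · exact Or.inr ⟨h.neg_one_zpow, h.neg_one_zpow⟩

/-- Under the glide reflection both `exp (π i x)` and `sin (2 π y)` change sign, so their product
does not. -/
theorem kleinInvariant_eq_of_rel {p q : ℝ × ℝ} (h : kleinSetoid p q) :
    kleinInvariant p = kleinInvariant q := by
  obtain ⟨m, n, h1, h2⟩ := h
  have e1 : Complex.exp (q.1 * (2 * Real.pi * Complex.I)) =
      Complex.exp (p.1 * (2 * Real.pi * Complex.I)) := by
    rw [Complex.exp_eq_exp_iff_exists_int]
    exact ⟨m, by rw [h1]; push_cast; ring⟩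
  have e3 := exp_add_int_mul_pi_mul_I p.1 m
  rw [← h1] at e3
  rcases neg_one_zpow_cases m with ⟨h3, h4⟩ | ⟨h3, h4⟩
  · have e : 2 * Real.pi * q.2 = 2 * Real.pi * p.2 + n * (2 * Real.pi) := by rw [h2, h3]; ring
    simp only [kleinInvariant, e1, e, Real.cos_add_int_mul_two_pi, Real.sin_add_int_mul_two_pi, e3,
      h4, one_mul]
  · have e : 2 * Real.pi * q.2 = -(2 * Real.pi * p.2) + n * (2 * Real.pi) := by rw [h2, h3]; ring
    simp only [kleinInvariant, e1, e, Real.cos_add_int_mul_two_pi, Real.sin_add_int_mul_two_pi, e3,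
      h4, Real.cos_neg, Real.sin_neg]
    simp

/-- The first invariant gives `x` up to an integer `m`, the cosine gives `y` up to sign and
integers. The third ties that sign to the parity of `m`, unless the sine vanishes. -/
theorem rel_of_kleinInvariant_eq {p q : ℝ × ℝ} (h : kleinInvariant p = kleinInvariant q) :
    kleinSetoid p q := by
  simp only [kleinInvariant, Prod.mk.injEq] at h
  obtain ⟨h1, h2, h3⟩ := h
  obtain ⟨m, hm⟩ := Complex.exp_eq_exp_iff_exists_int.1 h1.symm
  have hm' : q.1 = p.1 + m := by
    have hne : (2 * Real.pi * Complex.I : ℂ) ≠ 0 := Complex.two_pi_I_ne_zero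
    have : (q.1 : ℂ) = p.1 + m := by
      apply mul_right_cancel₀ hne
      rw [hm]
      ring
    exact_mod_cast this
  have e3 := exp_add_int_mul_pi_mul_I p.1 m
  rw [← hm'] at e3
  rw [e3, mul_comm ((-1) ^ m), mul_assoc (Complex.exp _) ((-1) ^ m)] at h3
  have h4 := mul_left_cancel₀ (Complex.exp_ne_zero _) h3
  have hpi := Real.two_pi_pos
  obtain ⟨n, hn | hn⟩ := Real.cos_eq_cos_iff.1 h2
  · have hn' : q.2 = p.2 + n := by
      apply mul_left_cancel₀ hpi.ne'
      rw [hn]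
      ring
    rcases neg_one_zpow_cases m with ⟨h5, h6⟩ | ⟨h5, h6⟩
    · exact ⟨m, n, hm', by rw [h5, one_mul, hn']⟩
    · have e : 2 * Real.pi * q.2 = 2 * Real.pi * p.2 + n * (2 * Real.pi) := by rw [hn']; ring
      rw [h6, e, Real.sin_add_int_mul_two_pi] at h4
      have h7 : Real.sin (2 * Real.pi * p.2) = -1 * Real.sin (2 * Real.pi * p.2) := by
        exact_mod_cast h4
      -- The sign disagrees with the parity of `m`. Then `2 y` is an integer `r`, and `y` and `-y`
      -- differ by `r`, which is absorbed into the vertical translation.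
      have h8 : Real.sin (2 * Real.pi * p.2) = 0 := by linarith
      obtain ⟨r, hr⟩ := Real.sin_eq_zero_iff.1 h8
      have hr' : (r : ℝ) = 2 * p.2 := by
        apply mul_right_cancel₀ Real.pi_pos.ne'
        rw [hr]
        ring
      refine ⟨m, r + n, hm', ?_⟩
      rw [h5, hn']
      push_cast
      linarith
  · have hn' : q.2 = -p.2 + n := by
      apply mul_left_cancel₀ hpi.ne'
      rw [hn]
      ring
    rcases neg_one_zpow_cases m with ⟨h5, h6⟩ | ⟨h5, h6⟩
    · have e : 2 * Real.pi * q.2 = -(2 * Real.pi * p.2) + n * (2 * Real.pi) := by rw [hn']; ring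
      rw [h6, e, Real.sin_add_int_mul_two_pi, Real.sin_neg] at h4
      have h7 : Real.sin (2 * Real.pi * p.2) = 1 * -Real.sin (2 * Real.pi * p.2) := by
        exact_mod_cast h4
      have h8 : Real.sin (2 * Real.pi * p.2) = 0 := by linarith
      obtain ⟨r, hr⟩ := Real.sin_eq_zero_iff.1 h8
      have hr' : (r : ℝ) = 2 * p.2 := by
        apply mul_right_cancel₀ Real.pi_pos.ne'
        rw [hr]
        ring
      refine ⟨m, n - r, hm', ?_⟩
      rw [h5, hn']
      push_cast
      linarith
    · exact ⟨m, n, hm', by rw [h5, hn']; ring⟩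

instance : T2Space KleinBottle := by
  let f : KleinBottle → ℂ × ℝ × ℂ :=
    Quotient.lift kleinInvariant fun _ _ h => kleinInvariant_eq_of_rel h
  refine T2Space.of_injective_continuous (f := f) ?_ ?_
  · intro a b
    induction a, b using Quotient.inductionOn₂ with
    | h p q => exact fun h => Quotient.sound (rel_of_kleinInvariant_eq h)
  · refine Continuous.quotient_lift ?_ _
    unfold kleinInvariant
    fun_prop

/-! ### Coordinates adapted to the drum and to the strip above it -/

/-- The Klein bottle as a quotient of the plane by a group generated by
`(x, y) ↦ (x + (k + 1), k - y)` and `(x, y) ↦ (x, y + (k + 1))`. -/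
noncomputable def kleinPt (k : ℕ) (p : ℝ × ℝ) : KleinBottle :=
  Quotient.mk kleinSetoid (p.1 / (k + 1), (p.2 - k / 2) / (k + 1))

theorem kleinPt_continuous (k : ℕ) : Continuous (kleinPt k) := by
  have : Continuous (Quotient.mk kleinSetoid) := continuous_quotient_mk'
  exact this.comp (by fun_prop)

theorem kleinPt_eq_iff {k : ℕ} {x y x' y' : ℝ} : kleinPt k (x, y) = kleinPt k (x', y') ↔
    ∃ m n : ℤ, x' = x + m * (k + 1) ∧ y' - k / 2 = (-1) ^ m * (y - k / 2) + n * (k + 1) := by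
  have hk : (k : ℝ) + 1 ≠ 0 := by positivity
  refine Quotient.eq.trans (exists₂_congr fun m n => and_congr ?_ ?_)
  · simp only
    field_simp
  · simp only
    field_simp

theorem kleinPt_eq_iff_cases {k : ℕ} {x y x' y' : ℝ} : kleinPt k (x, y) = kleinPt k (x', y') ↔
    ∃ m n : ℤ, (x' = x + (2 * m) * (k + 1) ∧ y' = y + n * (k + 1)) ∨
      (x' = x + (2 * m + 1) * (k + 1) ∧ y' = k - y + n * (k + 1)) := by
  rw [kleinPt_eq_iff]
  constructor
  · rintro ⟨m, n, h1, h2⟩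
    rcases Int.even_or_odd' m with ⟨r, rfl | rfl⟩
    · refine ⟨r, n, Or.inl ⟨by rw [h1]; push_cast; ring, ?_⟩⟩
      rw [(even_two_mul r).neg_one_zpow] at h2
      linarith
    · refine ⟨r, n, Or.inr ⟨by rw [h1]; push_cast; ring, ?_⟩⟩
      rw [(odd_two_mul_add_one r).neg_one_zpow] at h2
      linarith
  · rintro ⟨m, n, ⟨h1, h2⟩ | ⟨h1, h2⟩⟩
    · refine ⟨2 * m, n, by rw [h1]; push_cast; ring, ?_⟩
      rw [(even_two_mul m).neg_one_zpow]
      linarith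
    · refine ⟨2 * m + 1, n, by rw [h1]; push_cast; ring, ?_⟩
      rw [(odd_two_mul_add_one m).neg_one_zpow]
      linarith

theorem kleinPt_add_right (k : ℕ) (x y : ℝ) : kleinPt k (x, y + (k + 1)) = kleinPt k (x, y) :=
  (kleinPt_eq_iff_cases.2 ⟨0, 1, Or.inl ⟨by simp, by simp⟩⟩).symm

theorem kleinPt_add_left (k : ℕ) (x y : ℝ) : kleinPt k (x + (k + 1), y) = kleinPt k (x, k - y) :=
  (kleinPt_eq_iff_cases.2 ⟨0, 0, Or.inr ⟨by simp, by simp⟩⟩).symm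

theorem int_eq_zero_of_abs_lt {K : ℝ} (hK : 0 < K) {n : ℤ} {x : ℝ} (h : x = n * K) (h1 : -K < x)
    (h2 : x < K) : n = 0 := by
  have h3 : (n : ℝ) < 1 := by
    by_contra hc
    nlinarith
  have h4 : (-1 : ℝ) < n := by
    by_contra hc
    nlinarith
  have h3' : n < 1 := by exact_mod_cast h3
  have h4' : -1 < n := by exact_mod_cast h4
  omega

theorem kleinPt_inj_of_near {k : ℕ} {x y x' y' : ℝ} (h : kleinPt k (x, y) = kleinPt k (x', y'))
    (hx : |x' - x| < k + 1) (hy : |y' - y| < k + 1) : x = x' ∧ y = y' := by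
  have hK : (0 : ℝ) < k + 1 := by positivity
  obtain ⟨m, n, h1, h2⟩ := kleinPt_eq_iff.1 h
  rw [abs_lt] at hx hy
  obtain rfl : m = 0 := int_eq_zero_of_abs_lt hK (x := x' - x) (by linarith) hx.1 hx.2
  rw [zpow_zero, one_mul] at h2
  obtain rfl : n = 0 := int_eq_zero_of_abs_lt hK (x := y' - y) (by linarith) hy.1 hy.2
  simp only [Int.cast_zero, zero_mul, add_zero] at h1 h2
  exact ⟨h1.symm, by linarith⟩

theorem exists_kleinPt_eq (k : ℕ) (p : KleinBottle) :
    ∃ x ∈ Set.Ico (0 : ℝ) (k + 1), ∃ y ∈ Set.Ico (0 : ℝ) (k + 1), kleinPt k (x, y) = p := by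
  have hK : (0 : ℝ) < k + 1 := by positivity
  obtain ⟨⟨u, v⟩, rfl⟩ := Quotient.exists_rep p
  have h0 : kleinPt k (u * (k + 1), v * (k + 1) + k / 2) = Quotient.mk kleinSetoid (u, v) := by
    refine congrArg (Quotient.mk kleinSetoid) (Prod.ext ?_ ?_)
    · simp only
      field_simp
    · simp only
      field_simp
      ring
  obtain ⟨m, hm, -⟩ := existsUnique_add_zsmul_mem_Ico hK (u * (k + 1)) 0
  obtain ⟨n, hn, -⟩ := existsUnique_add_zsmul_mem_Ico hK ((-1) ^ m * (v * (k + 1)) + k / 2) 0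
  simp only [zsmul_eq_mul, zero_add] at hm hn
  refine ⟨_, hm, _, hn, ?_⟩
  rw [← h0]
  refine (kleinPt_eq_iff.2 ⟨m, n, rfl, ?_⟩).symm
  rw [add_sub_cancel_right]
  ring

theorem kleinPt_drum_cases {k : ℕ} {x y x' y' : ℝ} (hy : y ∈ Set.Icc (0 : ℝ) k)
    (hy' : y' ∈ Set.Icc (0 : ℝ) k) (h : kleinPt k (x, y) = kleinPt k (x', y')) :
    ∃ m : ℤ, x' - x = m * (k + 1) ∧ (m = 0 → y = y') := by
  have hK : (0 : ℝ) < k + 1 := by positivity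
  obtain ⟨m, n, h1, h2⟩ := kleinPt_eq_iff.1 h
  refine ⟨m, by linarith, ?_⟩
  rintro rfl
  rw [zpow_zero, one_mul] at h2
  obtain rfl : n = 0 := int_eq_zero_of_abs_lt hK (x := y' - y) (by linarith)
    (by linarith [hy.2, hy'.1]) (by linarith [hy.1, hy'.2])
  simp only [Int.cast_zero, zero_mul, add_zero] at h2
  linarith

/-- Modulo `k + 1`, the reflection `y ↦ k - y` preserves both the heights `[0, k]` of the drum and
the heights `(k, k + 1)` of the strip. -/
theorem kleinPt_strip_ne_drum {k : ℕ} {x y x' τ : ℝ} (hy : y ∈ Set.Icc (0 : ℝ) k)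
    (hτ : τ ∈ Set.Ioo (0 : ℝ) 1) : kleinPt k (x', k + τ) ≠ kleinPt k (x, y) := by
  have hK : (0 : ℝ) < k + 1 := by positivity
  intro h
  obtain ⟨m, n, ⟨-, h2⟩ | ⟨-, h2⟩⟩ := kleinPt_eq_iff_cases.1 h.symm
  · obtain rfl : n = 0 := int_eq_zero_of_abs_lt hK (x := k + τ - y) (by linarith)
      (by linarith [hy.2, hτ.1]) (by linarith [hy.1, hτ.2])
    simp only [Int.cast_zero, zero_mul, add_zero] at h2
    linarith [hy.2, hτ.1]
  · obtain rfl : n = 0 := int_eq_zero_of_abs_lt hK (x := τ + y) (by linarith)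
      (by linarith [hy.1, hτ.1]) (by linarith [hy.2, hτ.2])
    simp only [Int.cast_zero, zero_mul, add_zero] at h2
    linarith [hy.1, hτ.1]

theorem kleinPt_strip_cases {k : ℕ} {x τ x' τ' : ℝ} (hτ : τ ∈ Set.Ioo (0 : ℝ) 1)
    (hτ' : τ' ∈ Set.Ioo (0 : ℝ) 1) (h : kleinPt k (x, k + τ) = kleinPt k (x', k + τ')) :
    ∃ m : ℤ, (x' = x + (2 * m) * (k + 1) ∧ τ' = τ) ∨
      (x' = x + (2 * m + 1) * (k + 1) ∧ τ' = 1 - τ) := by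
  have hK : (0 : ℝ) < k + 1 := by positivity
  obtain ⟨m, n, ⟨h1, h2⟩ | ⟨h1, h2⟩⟩ := kleinPt_eq_iff_cases.1 h
  · obtain rfl : n = 0 := int_eq_zero_of_abs_lt hK (x := τ' - τ) (by linarith)
      (by linarith [hτ.2, hτ'.1]) (by linarith [hτ.1, hτ'.2])
    simp only [Int.cast_zero, zero_mul, add_zero] at h2
    exact ⟨m, Or.inl ⟨h1, by linarith⟩⟩
  -- The reflection takes height `k + τ` to `-τ`; one translation by `k + 1` brings it back to `k +
  -- (1 - τ)`.
  · have hn : n - 1 = 0 := int_eq_zero_of_abs_lt hK (x := τ' + τ - 1) (by push_cast; linarith)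
      (by linarith [hτ.1, hτ'.1]) (by linarith [hτ.2, hτ'.2])
    obtain rfl : n = 1 := by omega
    simp only [Int.cast_one, one_mul] at h2
    exact ⟨m, Or.inr ⟨h1, by linarith⟩⟩

/-- Between its two boundary rows, the strip above row `k` has as a fundamental domain the region
between two slanted arcs. -/
theorem kleinPt_strip_inj {k : ℕ} {x τ x' τ' : ℝ} (hτ : τ ∈ Set.Ioo (0 : ℝ) 1)
    (hτ' : τ' ∈ Set.Ioo (0 : ℝ) 1) (hx : x ∈ Set.Ico (-1 + τ) (k + 1 - τ))
    (hx' : x' ∈ Set.Ico (-1 + τ') (k + 1 - τ'))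
    (h : kleinPt k (x, k + τ) = kleinPt k (x', k + τ')) : x = x' ∧ τ = τ' := by
  have hK : (0 : ℝ) < k + 1 := by positivity
  have hk : (0 : ℝ) ≤ k := k.cast_nonneg
  obtain ⟨m, ⟨h1, h2⟩ | ⟨h1, h2⟩⟩ := kleinPt_strip_cases hτ hτ' h
  · obtain rfl : m = 0 := int_eq_zero_of_abs_lt (K := 2 * (k + 1)) (by linarith) (x := x' - x)
      (by linarith) (by linarith [hτ.1, hx.2, hx'.1]) (by linarith [hτ.1, hx.1, hx'.2])
    simp only [Int.cast_zero, mul_zero, zero_mul, add_zero] at h1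
    exact ⟨h1.symm, h2.symm⟩
  · subst h2
    exfalso
    -- For `m ≥ 0` the glide carries the left boundary to the excluded right boundary `k + 1 - τ'`
    -- or beyond; for `m ≤ -1` it lands strictly left of `-1 + τ'`.
    have h3 : m < 0 := by
      by_contra hc
      have : (0 : ℝ) ≤ m := by exact_mod_cast not_lt.1 hc
      nlinarith [hx.1, hx'.2]
    have h4 : -1 < m := by
      by_contra hc
      have : (m : ℝ) ≤ -1 := by exact_mod_cast not_lt.1 hc
      nlinarith [hx.2, hx'.1]
    omega

theorem kleinPt_strip_inj_Ico {k : ℕ} {x τ x' τ' : ℝ} (hτ : τ ∈ Set.Ioo (0 : ℝ) 1)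
    (hτ' : τ' ∈ Set.Ioo (0 : ℝ) 1) (hx : x ∈ Set.Ico (0 : ℝ) (k + 1))
    (hx' : x' ∈ Set.Ico (0 : ℝ) (k + 1))
    (h : kleinPt k (x, k + τ) = kleinPt k (x', k + τ')) : x = x' ∧ τ = τ' := by
  refine (kleinPt_inj_of_near h ?_ ?_).imp_right fun h => by linarith
  · rw [abs_lt]
    exact ⟨by linarith [hx.2, hx'.1], by linarith [hx.1, hx'.2]⟩
  · have : (0 : ℝ) ≤ k := k.cast_nonneg
    rw [abs_lt]
    exact ⟨by linarith [hτ.2, hτ'.1], by linarith [hτ.1, hτ'.2]⟩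

theorem drumPoint_kleinPt {k : ℕ} (i : Fin (k + 1)) (j : Fin (2 * k + 2)) :
    drumPoint k (kleinPt k) (drumMk k i j) = kleinPt k (j.val, i.val) := by
  rcases le_or_gt j.val k with h | h
  · exact drumPoint_mk_of_le _ _ h
  · rw [drumPoint_mk_of_lt _ _ h, ← kleinPt_add_left, sub_add_cancel]

theorem kleinPt_glue (k : ℕ) (y : ℝ) : kleinPt k (k + 1, y) = kleinPt k (0, k - y) := by
  rw [← kleinPt_add_left, zero_add]

theorem kleinPt_chart_inj {k : ℕ} {x y x' y' : ℝ} (hx : x ∈ Set.Icc (0 : ℝ) (k + 1))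
    (hy : y ∈ Set.Icc (0 : ℝ) k) (hx' : x' ∈ Set.Icc (0 : ℝ) (k + 1)) (hy' : y' ∈ Set.Icc (0 : ℝ) k)
    (h : kleinPt k (x, y) = kleinPt k (x', y')) :
    (x = x' ∧ y = y') ∨ (x = 0 ∧ x' = k + 1) ∨ (x = k + 1 ∧ x' = 0) := by
  have hK : (0 : ℝ) < k + 1 := by positivity
  obtain ⟨m, h1, h2⟩ := kleinPt_drum_cases hy hy' h
  by_cases h3 : x' - x = k + 1
  · exact Or.inr (Or.inl ⟨by linarith [hx.1, hx'.2], by linarith [hx.1, hx'.2]⟩)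
  · by_cases h4 : x' - x = -(k + 1)
    · exact Or.inr (Or.inr ⟨by linarith [hx.2, hx'.1], by linarith [hx.2, hx'.1]⟩)
    · obtain rfl : m = 0 := int_eq_zero_of_abs_lt hK h1
        (lt_of_le_of_ne (by linarith [hx.2, hx'.1]) (Ne.symm h4))
        (lt_of_le_of_ne (by linarith [hx.1, hx'.2]) h3)
      simp only [Int.cast_zero, zero_mul] at h1
      exact Or.inl ⟨by linarith, h2 rfl⟩

theorem kleinPt_drum_or_strip (k : ℕ) (p : KleinBottle) :
    (∃ x ∈ Set.Icc (0 : ℝ) (k + 1), ∃ y ∈ Set.Icc (0 : ℝ) k, kleinPt k (x, y) = p) ∨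
    ∃ x ∈ Set.Ico (0 : ℝ) (k + 1), ∃ τ ∈ Set.Ioo (0 : ℝ) 1, kleinPt k (x, k + τ) = p := by
  obtain ⟨x, hx, y, hy, rfl⟩ := exists_kleinPt_eq k p
  rcases le_or_gt y k with h | h
  · exact Or.inl ⟨x, Set.Ico_subset_Icc_self hx, y, ⟨hy.1, h⟩, rfl⟩
  · exact Or.inr ⟨x, hx, y - k, ⟨by linarith, by linarith [hy.2]⟩, by rw [add_sub_cancel]⟩

/-! ### Quadrangulating the Klein bottle -/

/-- For even `k` the strip above the top row is filled by vertical edges and squares. -/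
noncomputable def kleinFillingEven (k : ℕ) (hk : 2 ≤ k) (he : Even k) :
    DrumFilling k (extraY k) KleinBottle (Fin (k + 1)) (Fin (k + 1)) where
  chart := kleinPt k
  chart_continuous := kleinPt_continuous k
  chart_glue y _ := kleinPt_glue k y
  chart_inj _ _ _ _ hx hy hx' hy' h := kleinPt_chart_inj hx hy hx' hy' h
  src a := drumMk k (Fin.last k) ⟨a, by omega⟩
  tgt a := drumMk k 0 ⟨a, by omega⟩
  arc a t := kleinPt k (a.val, k + t)
  face a z := kleinPt k (a.val + z.1, k + z.2)
  arc_continuous a := (kleinPt_continuous k).comp (by fun_prop)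
  face_continuous a := (kleinPt_continuous k).comp (by fun_prop)
  arc_zero a := by
    rw [drumPoint_kleinPt]
    simp
  arc_one a := by
    rw [drumPoint_kleinPt]
    have := kleinPt_add_right k a.val 0
    rw [zero_add] at this
    rw [this]
    simp
  exists_adj a := by
    refine ⟨⟨a + (k + 1), by omega⟩, ⟨a, by omega⟩, ?_, ?_⟩
    · rw [extraY, SimpleGraph.fromRel_adj]
      exact ⟨by simp [Fin.ext_iff], Or.inr (Or.inl ⟨he, rfl⟩)⟩
    · refine congrArg₂ (fun u v => s(u, v)) ?_ rfl
      rw [drumMk_eq_iff]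
      simp
  exists_edge a b hab := by
    right
    rw [extraY, SimpleGraph.fromRel_adj] at hab
    have hno : ¬Odd k := Nat.not_odd_iff_even.2 he
    obtain ⟨-, (⟨-, h⟩ | ⟨h, -⟩) | (⟨-, h⟩ | ⟨h, -⟩)⟩ := hab
    · refine ⟨⟨a, by omega⟩, (congrArg₂ (fun u v => s(u, v)) ?_ rfl).trans Sym2.eq_swap⟩
      rw [drumMk_eq_iff]
      simp [h]
    · exact absurd h hno
    · refine ⟨⟨b, by omega⟩, congrArg₂ (fun u v => s(u, v)) ?_ rfl⟩
      rw [drumMk_eq_iff]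
      simp [h]
    · exact absurd h hno
  edge_injective := by
    intro a b h
    simp only [Sym2.eq_iff, drumMk_eq_iff, Fin.val_last, Fin.val_zero] at h
    ext
    omega
  edge_ne d a h := by
    rcases d with ⟨⟨c, hc⟩, ⟨d, hd⟩⟩ | ⟨⟨c, hc⟩, ⟨d, hd⟩⟩ <;>
    simp only [drumSrc, drumTgt, Sym2.eq_iff, drumMk_eq_iff, Fin.val_last, Fin.val_zero,
      Fin.val_castSucc, Fin.val_succ] at h <;> omega
  side_bottom a := by
    refine ⟨.inl (.inl (a, Fin.last k)), Or.inl fun t _ => ?_⟩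
    simp [drumArc]
  side_right a := by
    by_cases h : a.val < k
    · exact ⟨.inr ⟨a + 1, by omega⟩, Or.inl fun t _ => by simp⟩
    · refine ⟨.inr 0, Or.inr fun t _ => ?_⟩
      -- The last square closes the Möbius band: its right side is the glide image of the arc at
      -- `0`, turned upside down.
      have ha : a.val = k := by omega
      have := kleinPt_add_right k 0 (k - (k + t))
      simp only [Sum.elim_inr, ha, Fin.val_zero, Nat.cast_zero]
      rw [kleinPt_glue, ← this]
      congr 2
      ring
  side_top a := by
    refine ⟨.inl (.inl (a, 0)), Or.inl fun t _ => ?_⟩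
    have := kleinPt_add_right k (a.val + t) 0
    rw [zero_add] at this
    simpa [drumArc] using this
  side_left a := ⟨.inr a, Or.inl fun t _ => by simp⟩
  face_injOn a := by
    rintro ⟨s, t⟩ ⟨hs, ht⟩ ⟨s', t'⟩ ⟨hs', ht'⟩ h
    simp only at hs ht hs' ht'
    have hkR : (2 : ℝ) ≤ k := by exact_mod_cast hk
    obtain ⟨h1, h2⟩ := kleinPt_inj_of_near h
      (abs_lt.2 ⟨by linarith [hs.2, hs'.1], by linarith [hs.1, hs'.2]⟩)
      (abs_lt.2 ⟨by linarith [ht.2, ht'.1], by linarith [ht.1, ht'.2]⟩)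
    simp only at h1 h2
    exact Prod.ext (by simp only; linarith) (by simp only; linarith)
  arc_ne_chart a t x y ht _ hy := kleinPt_strip_ne_drum hy ht
  face_ne_chart a z x y hz _ hy := kleinPt_strip_ne_drum hy hz.2
  face_ne_arc a z b t hz ht h := by
    have ha : (a.val : ℝ) ≤ k := by exact_mod_cast Nat.lt_succ_iff.1 a.2
    have hb : (b.val : ℝ) ≤ k := by exact_mod_cast Nat.lt_succ_iff.1 b.2
    obtain ⟨h1, -⟩ := kleinPt_strip_inj_Ico hz.2 ht
      ⟨add_nonneg (Nat.cast_nonneg _) hz.1.1.le, by linarith [hz.1.2]⟩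
      ⟨Nat.cast_nonneg _, by linarith⟩ h
    rw [← add_zero (b.val : ℝ)] at h1
    exact hz.1.1.ne' (natCast_add_inj (Set.Ioo_subset_Ico_self hz.1) ⟨le_rfl, one_pos⟩ h1).2
  arc_inj a b t t' ht ht' h := by
    have ha : (a.val : ℝ) ≤ k := by exact_mod_cast Nat.lt_succ_iff.1 a.2
    have hb : (b.val : ℝ) ≤ k := by exact_mod_cast Nat.lt_succ_iff.1 b.2
    obtain ⟨h1, h2⟩ := kleinPt_strip_inj_Ico ht ht' ⟨Nat.cast_nonneg _, by linarith⟩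
      ⟨Nat.cast_nonneg _, by linarith⟩ h
    exact ⟨Fin.ext (by exact_mod_cast h1), h2⟩
  face_inj a b z z' hz hz' h := by
    have ha : (a.val : ℝ) ≤ k := by exact_mod_cast Nat.lt_succ_iff.1 a.2
    have hb : (b.val : ℝ) ≤ k := by exact_mod_cast Nat.lt_succ_iff.1 b.2
    obtain ⟨h1, -⟩ := kleinPt_strip_inj_Ico hz.2 hz'.2
      ⟨add_nonneg (Nat.cast_nonneg _) hz.1.1.le, by linarith [hz.1.2]⟩
      ⟨add_nonneg (Nat.cast_nonneg _) hz'.1.1.le, by linarith [hz'.1.2]⟩ h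
    exact Fin.ext (natCast_add_inj (Set.Ioo_subset_Ico_self hz.1)
      (Set.Ioo_subset_Ico_self hz'.1) h1).1
  cover p := by
    rcases kleinPt_drum_or_strip k p with h | ⟨x, hx, τ, hτ, rfl⟩
    · exact Or.inl h
    · right
      obtain ⟨a, s, hs, rfl⟩ := exists_natCast_add hx.1
      have ha : a < k + 1 := by
        have : (a : ℝ) < k + 1 := by linarith [hs.1, hx.2]
        exact_mod_cast this
      rcases hs.1.eq_or_lt with rfl | hs0
      · exact Or.inl ⟨⟨a, ha⟩, τ, hτ, by simp⟩
      · exact Or.inr ⟨⟨a, ha⟩, (s, τ), ⟨⟨hs0, hs.2⟩, hτ⟩, rfl⟩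

/-- The slanted squares in the strip above the top row, and one square folded around the top
vertex at position `k`. -/
def slantedFace (k : ℕ) : Option (Fin k) → ℝ × ℝ → ℝ × ℝ
  | some a, z => (a.val - 1 + z.1 + z.2, k + z.2)
  | none, z => (k + z.1 - z.2, k + min z.1 z.2)

/-- A pair is determined by its difference and its minimum, which settles the folded square; the
others are sheared squares. -/
theorem slantedFace_injective {k : ℕ} (f : Option (Fin k)) :
    Function.Injective (slantedFace k f) := by
  rintro ⟨s, t⟩ ⟨s', t'⟩ h
  rcases f with _ | a
  · simp only [slantedFace, Prod.mk.injEq] at h ⊢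
    rcases le_total s t with h1 | h1 <;> rcases le_total s' t' with h2 | h2 <;>
    simp only [h1, h2, min_eq_left, min_eq_right] at h <;>
    exact ⟨by linarith [h.1, h.2], by linarith [h.1, h.2]⟩
  · simp only [slantedFace, Prod.mk.injEq] at h ⊢
    exact ⟨by linarith [h.1, h.2], by linarith [h.1, h.2]⟩

/-- With `2 < k + 1` these bounds allow `kleinPt_inj_of_near` to show that each closed face is
embedded, including the folded one, of width `2`. -/
theorem slantedFace_dist {k : ℕ} (f : Option (Fin k)) {z z' : ℝ × ℝ}
    (hz : z ∈ Set.Icc (0 : ℝ) 1 ×ˢ Set.Icc (0 : ℝ) 1)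
    (hz' : z' ∈ Set.Icc (0 : ℝ) 1 ×ˢ Set.Icc (0 : ℝ) 1) :
    |(slantedFace k f z').1 - (slantedFace k f z).1| ≤ 2 ∧
      |(slantedFace k f z').2 - (slantedFace k f z).2| ≤ 1 := by
  obtain ⟨⟨h1, h2⟩, h3, h4⟩ := hz
  obtain ⟨⟨h5, h6⟩, h7, h8⟩ := hz'
  have m1 := le_min h1 h3
  have m2 := (min_le_left z.1 z.2).trans h2
  have m3 := le_min h5 h7
  have m4 := (min_le_left z'.1 z'.2).trans h6
  rw [abs_le, abs_le]
  rcases f with _ | a <;> simp only [slantedFace] <;>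
    refine ⟨⟨?_, ?_⟩, ?_, ?_⟩ <;> linarith

/-- The sheared coordinate `x - τ + 1` is constant along slanted arcs, with value `a` on the arc at
`a`. It therefore tells the faces apart: it lies in `(a, a + 1)` on the slanted square `a` and
exceeds `k` on the folded one. -/
theorem slantedFace_eq {k : ℕ} (f : Option (Fin k)) {z : ℝ × ℝ}
    (hz : z ∈ Set.Ioo (0 : ℝ) 1 ×ˢ Set.Ioo (0 : ℝ) 1) :
    ∃ x, ∃ τ ∈ Set.Ioo (0 : ℝ) 1, slantedFace k f z = (x, k + τ) ∧
      x ∈ Set.Ico (-1 + τ) (k + 1 - τ) ∧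
      ((∃ a s, f = some a ∧ s ∈ Set.Ioo (0 : ℝ) 1 ∧ x - τ + 1 = a.val + s) ∨
        (f = none ∧ k < x - τ + 1)) := by
  obtain ⟨s, t⟩ := z
  obtain ⟨⟨h1, h2⟩, h3, h4⟩ := hz
  simp only at h1 h2 h3 h4
  rcases f with _ | a
  · have hk : (0 : ℝ) ≤ k := k.cast_nonneg
    refine ⟨_, min s t, ⟨lt_min h1 h3, (min_le_left s t).trans_lt h2⟩, rfl, ⟨?_, ?_⟩,
      Or.inr ⟨rfl, ?_⟩⟩ <;> simp only <;> rcases le_total s t with h | h <;>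
      simp only [h, min_eq_left, min_eq_right] <;> linarith
  · have ha : (a.val : ℝ) + 1 ≤ k := by exact_mod_cast a.2
    have ha0 : (0 : ℝ) ≤ a.val := Nat.cast_nonneg _
    exact ⟨_, t, ⟨h3, h4⟩, rfl, ⟨by simp only; linarith, by simp only; linarith⟩,
      Or.inl ⟨a, s, rfl, ⟨h1, h2⟩, by ring⟩⟩

/-- For odd `k` the strip above the top row is filled by slanted edges and squares. -/
noncomputable def kleinFillingOdd (k : ℕ) (hk : 2 ≤ k) (ho : Odd k) :
    DrumFilling k (extraY k) KleinBottle (Fin (k + 1)) (Option (Fin k)) where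
  chart := kleinPt k
  chart_continuous := kleinPt_continuous k
  chart_glue y _ := kleinPt_glue k y
  chart_inj _ _ _ _ hx hy hx' hy' h := kleinPt_chart_inj hx hy hx' hy' h
  src a := drumMk k 0 ⟨a + k, by omega⟩
  tgt a := drumMk k 0 ⟨a, by omega⟩
  arc a t := kleinPt k (a.val - 1 + t, k + t)
  face f z := kleinPt k (slantedFace k f z)
  arc_continuous a := (kleinPt_continuous k).comp (by fun_prop)
  face_continuous f := by
    refine (kleinPt_continuous k).comp ?_
    rcases f with _ | a <;> unfold slantedFace <;> fun_prop
  arc_zero a := by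
    -- The arc starts at `(a - 1, k)`, which is glued to `(a + k, 0)`.
    have := kleinPt_add_left k (a.val - 1) 0
    rw [drumPoint_kleinPt]
    simp only [add_zero, Fin.val_zero, Nat.cast_zero, Nat.cast_add]
    rw [sub_zero] at this
    rw [← this]
    congr 2
    ring
  arc_one a := by
    rw [drumPoint_kleinPt]
    have := kleinPt_add_right k a.val 0
    rw [zero_add] at this
    rw [sub_add_cancel, this]
    simp
  exists_adj a := by
    refine ⟨⟨a + k, by omega⟩, ⟨a, by omega⟩, ?_, rfl⟩
    rw [extraY, SimpleGraph.fromRel_adj]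
    exact ⟨by simp [Fin.ext_iff]; omega, Or.inr (Or.inr ⟨ho, by simp only; omega, rfl⟩)⟩
  exists_edge a b hab := by
    right
    rw [extraY, SimpleGraph.fromRel_adj] at hab
    have hne : ¬Even k := Nat.not_even_iff_odd.2 ho
    obtain ⟨-, (⟨h, -⟩ | ⟨-, h0, h⟩) | (⟨h, -⟩ | ⟨-, h0, h⟩)⟩ := hab
    · exact absurd h hne
    · have hb : b = ⟨a + k, by omega⟩ := Fin.ext h
      exact ⟨⟨a, by omega⟩,
        (congrArg (fun c => s(drumMk k 0 c, drumMk k 0 a)) hb.symm).trans Sym2.eq_swap⟩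
    · exact absurd h hne
    · have ha : a = ⟨b + k, by omega⟩ := Fin.ext h
      exact ⟨⟨b, by omega⟩, congrArg (fun c => s(drumMk k 0 c, drumMk k 0 b)) ha.symm⟩
  edge_injective := by
    intro a b h
    simp only [Sym2.eq_iff, drumMk_eq_iff, Fin.val_zero] at h
    ext
    omega
  edge_ne d a h := by
    obtain ⟨r, hr⟩ := ho
    rcases d with ⟨⟨c, hc⟩, ⟨d, hd⟩⟩ | ⟨⟨c, hc⟩, ⟨d, hd⟩⟩ <;>
    simp only [drumSrc, drumTgt, Sym2.eq_iff, drumMk_eq_iff, Fin.val_zero,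
      Fin.val_castSucc, Fin.val_succ] at h <;> omega
  side_bottom f := by
    rcases f with _ | ⟨a, ha⟩
    · refine ⟨.inl (.inl (Fin.last k, Fin.last k)), Or.inl fun t ht => ?_⟩
      simp [drumArc, slantedFace, ht.1]
    -- The first slanted square starts at `x = -1`, left of the chart; the glide moves its bottom
    -- side to row `0`, column `k`.
    · by_cases h : a = 0
      · subst h
        refine ⟨.inl (.inl (Fin.last k, 0)), Or.inl fun t _ => ?_⟩
        have := kleinPt_add_left k (-1 + t) 0
        simp only [slantedFace, drumArc, Sum.elim_inl, Fin.val_last, Fin.val_zero, Nat.cast_zero,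
          add_zero, zero_sub]
        rw [sub_zero] at this
        rw [← this]
        congr 2
        ring
      · refine ⟨.inl (.inl (⟨a - 1, by omega⟩, Fin.last k)), Or.inl fun t _ => ?_⟩
        simp only [slantedFace, drumArc, Sum.elim_inl, Fin.val_last, add_zero]
        rw [Nat.cast_sub (by omega), Nat.cast_one]
  side_right f := by
    rcases f with _ | ⟨a, ha⟩
    -- The folded square fills the triangle with corners `(k - 1, k)`, `(k + 1, k)`, `(k, k + 1)`.
    -- This side, from `(k + 1, k)` to `(k, k + 1)`, is the glide image of the arc at `0`, reversed.
    · refine ⟨.inr 0, Or.inr fun t ht => ?_⟩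
      have h1 := kleinPt_add_left k (-t) (k + t)
      have h2 := kleinPt_add_right k (-t) (k - (k + t))
      simp only [slantedFace, Sum.elim_inr, min_eq_right ht.2, Fin.val_zero, Nat.cast_zero,
        zero_sub]
      rw [show (k : ℝ) + 1 - t = -t + (k + 1) by ring, h1, ← h2]
      congr 2 <;> ring
    · refine ⟨.inr ⟨a + 1, by omega⟩, Or.inl fun t _ => ?_⟩
      simp [slantedFace]
  side_top f := by
    rcases f with _ | ⟨a, ha⟩
    · refine ⟨.inr (Fin.last k), Or.inl fun t ht => ?_⟩
      simp only [slantedFace, Sum.elim_inr, min_eq_left ht.2, Fin.val_last]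
      congr 2
      ring
    · refine ⟨.inl (.inl (⟨a, by omega⟩, 0)), Or.inl fun t _ => ?_⟩
      have := kleinPt_add_right k (a + t) 0
      rw [zero_add] at this
      simp only [slantedFace, drumArc, Sum.elim_inl, Fin.val_zero, Nat.cast_zero]
      rw [← this]
      congr 2
      ring
  side_left f := by
    rcases f with _ | ⟨a, ha⟩
    · refine ⟨.inl (.inl (⟨k - 1, by omega⟩, Fin.last k)), Or.inr fun t ht => ?_⟩
      simp only [slantedFace, drumArc, Sum.elim_inl, Fin.val_last, min_eq_left ht.1, add_zero]
      rw [Nat.cast_sub (by omega), Nat.cast_one]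
      congr 2
      ring
    · refine ⟨.inr ⟨a, by omega⟩, Or.inl fun t _ => ?_⟩
      simp [slantedFace]
  face_injOn f := by
    intro z hz z' hz' h
    have hkR : (2 : ℝ) ≤ k := by exact_mod_cast hk
    obtain ⟨hd1, hd2⟩ := slantedFace_dist (k := k) f hz hz'
    obtain ⟨h1, h2⟩ := kleinPt_inj_of_near h (hd1.trans_lt (by linarith)) (hd2.trans_lt (by linarith))
    exact slantedFace_injective f (Prod.ext h1 h2)
  arc_ne_chart a t x y ht _ hy := kleinPt_strip_ne_drum hy ht
  face_ne_chart f z x y hz _ hy h := by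
    obtain ⟨x', τ, hτ, hf, -⟩ := slantedFace_eq (k := k) f hz
    rw [hf] at h
    exact kleinPt_strip_ne_drum hy hτ h
  face_ne_arc f z b t hz ht h := by
    have hb : (b.val : ℝ) ≤ k := by exact_mod_cast Nat.lt_succ_iff.1 b.2
    have hb0 : (0 : ℝ) ≤ b.val := Nat.cast_nonneg _
    obtain ⟨x, τ, hτ, hf, hx, hc⟩ := slantedFace_eq (k := k) f hz
    rw [hf] at h
    obtain ⟨h1, h2⟩ := kleinPt_strip_inj hτ ht hx ⟨by linarith, by linarith [ht.2]⟩ h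
    rcases hc with ⟨a, s, -, hs, h3⟩ | ⟨-, h3⟩
    · have h4 : (a.val : ℝ) + s = b.val + 0 := by linarith
      exact hs.1.ne' (natCast_add_inj (Set.Ioo_subset_Ico_self hs) ⟨le_rfl, one_pos⟩ h4).2
    · linarith
  arc_inj a b t t' ht ht' h := by
    have ha : (a.val : ℝ) ≤ k := by exact_mod_cast Nat.lt_succ_iff.1 a.2
    have ha0 : (0 : ℝ) ≤ a.val := Nat.cast_nonneg _
    have hb : (b.val : ℝ) ≤ k := by exact_mod_cast Nat.lt_succ_iff.1 b.2
    have hb0 : (0 : ℝ) ≤ b.val := Nat.cast_nonneg _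
    obtain ⟨h1, h2⟩ := kleinPt_strip_inj ht ht' ⟨by linarith, by linarith [ht.2]⟩
      ⟨by linarith, by linarith [ht'.2]⟩ h
    have h3 : (a.val : ℝ) = b.val := by linarith
    exact ⟨Fin.ext (by exact_mod_cast h3), h2⟩
  face_inj f f' z z' hz hz' h := by
    obtain ⟨x, τ, hτ, hf, hx, hc⟩ := slantedFace_eq (k := k) f hz
    obtain ⟨x', τ', hτ', hf', hx', hc'⟩ := slantedFace_eq (k := k) f' hz'
    rw [hf, hf'] at h
    obtain ⟨rfl, rfl⟩ := kleinPt_strip_inj hτ hτ' hx hx' h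
    have key (a : Fin k) (s : ℝ) (hs : s ∈ Set.Ioo (0 : ℝ) 1) (h1 : x - τ + 1 = a.val + s)
        (h2 : k < x - τ + 1) : False := by
      have : (a.val : ℝ) + 1 ≤ k := by exact_mod_cast a.2
      linarith [hs.2]
    rcases hc with ⟨a, s, rfl, hs, h3⟩ | ⟨rfl, h3⟩ <;>
    rcases hc' with ⟨b, s', rfl, hs', h3'⟩ | ⟨rfl, h3'⟩
    · exact congrArg some (Fin.ext (natCast_add_inj (Set.Ioo_subset_Ico_self hs)
        (Set.Ioo_subset_Ico_self hs') (h3.symm.trans h3')).1)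
    · exact (key a s hs h3 h3').elim
    · exact (key b s' hs' h3' h3).elim
    · rfl
  cover p := by
    rcases kleinPt_drum_or_strip k p with h | ⟨x, hx, τ, hτ, rfl⟩
    · exact Or.inl h
    right
    -- The arc at `k` is `x = k - 1 + τ`. Up to it the slanted squares and arcs cover; then come the
    -- triangle, its right side `x = k + 1 - τ`, and a remainder that the glide takes back into the
    -- slanted square `0`.
    rcases le_or_gt x (k - 1 + τ) with h | h
    · obtain ⟨a, s, hs, hxa⟩ := exists_natCast_add (x := x - τ + 1) (by linarith [hx.1, hτ.2])
      have ha : a ≤ k := by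
        have : (a : ℝ) ≤ k := by linarith [hs.1]
        exact_mod_cast this
      rcases hs.1.eq_or_lt with rfl | hs0
      · refine Or.inl ⟨⟨a, by omega⟩, τ, hτ, ?_⟩
        congr 2
        simp only
        linarith
      · have ha' : a < k := by
          have : (a : ℝ) < k := by linarith
          exact_mod_cast this
        refine Or.inr ⟨some ⟨a, ha'⟩, (s, τ), ⟨⟨hs0, hs.2⟩, hτ⟩, ?_⟩
        simp only [slantedFace]
        congr 2
        linarith
    · rcases lt_trichotomy x (k + 1 - τ) with h' | h' | h'
      · right
        rcases le_total x k with hxk | hxk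
        · refine ⟨none, (τ, τ + (k - x)), ⟨hτ, ⟨by simp only; linarith [hτ.1],
            by simp only; linarith⟩⟩, ?_⟩
          simp only [slantedFace]
          rw [min_eq_left (by linarith)]
          congr 2
          ring
        · refine ⟨none, (τ + (x - k), τ), ⟨⟨by simp only; linarith [hτ.1],
            by simp only; linarith⟩, hτ⟩, ?_⟩
          simp only [slantedFace]
          rw [min_eq_right (by linarith)]
          congr 2
          ring
      · refine Or.inl ⟨0, 1 - τ, ⟨by linarith [hτ.2], by linarith [hτ.1]⟩, ?_⟩
        have h1 := kleinPt_add_left k (-τ) (k + τ)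
        have h2 := kleinPt_add_right k (-τ) (k - (k + τ))
        rw [h', show (k : ℝ) + 1 - τ = -τ + (k + 1) by ring, h1, ← h2]
        simp only [Fin.val_zero, Nat.cast_zero]
        congr 2 <;> ring
      · refine Or.inr ⟨some ⟨0, by omega⟩, (x - (k + 1 - τ), 1 - τ), ⟨⟨by simp only; linarith,
          by simp only; linarith [hx.2, hτ.2]⟩, ⟨by simp only; linarith [hτ.2],
          by simp only; linarith [hτ.1]⟩⟩, ?_⟩
        have h1 := kleinPt_add_left k (x - (k + 1)) (k + τ)
        have h2 := kleinPt_add_right k (x - (k + 1)) (k - (k + τ))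
        rw [sub_add_cancel] at h1
        rw [h1, ← h2]
        simp only [slantedFace, Nat.cast_zero]
        congr 2 <;> ring

theorem graphY_quadrangulates {k : ℕ} (hk : 2 ≤ k) : Quadrangulates (graphY k) KleinBottle := by
  rcases Nat.even_or_odd k with h | h
  · exact (kleinFillingEven k hk h).quadrangulates hk
  · exact (kleinFillingOdd k hk h).quadrangulates hk

/-! ### The projective plane -/

/-- The point of the projective plane with the given homogeneous coordinates. -/
noncomputable def rpMk (v : Fin 3 → ℝ) (hv : v ≠ 0) : RealProjectivePlane :=
  Quotient.mk (projectivizationSetoid ℝ (Fin 3 → ℝ)) ⟨v, hv⟩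

theorem rpMk_eq_iff {v w : Fin 3 → ℝ} {hv : v ≠ 0} {hw : w ≠ 0} :
    rpMk v hv = rpMk w hw ↔ ∃ c : ℝ, c • w = v :=
  Projectivization.mk_eq_mk_iff' ℝ v w hv hw

theorem exists_rpMk_eq (p : RealProjectivePlane) : ∃ v hv, rpMk v hv = p := by
  obtain ⟨⟨v, hv⟩, rfl⟩ := Quotient.exists_rep p
  exact ⟨v, hv, rfl⟩

theorem continuous_rpMk {X : Type*} [TopologicalSpace X] {f : X → Fin 3 → ℝ} (hf : Continuous f)
    (h0 : ∀ x, f x ≠ 0) : Continuous fun x => rpMk (f x) (h0 x) := by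
  have : Continuous (Quotient.mk (projectivizationSetoid ℝ (Fin 3 → ℝ))) :=
    continuous_quotient_mk'
  exact this.comp (hf.subtype_mk h0)

theorem rpMk_neg {v : Fin 3 → ℝ} (hv : v ≠ 0) : rpMk (-v) (neg_ne_zero.2 hv) = rpMk v hv :=
  rpMk_eq_iff.2 ⟨-1, by simp⟩

/-- The matrix of the orthogonal projection to a line, in terms of a vector spanning it. -/
noncomputable def lineInvariant (v : Fin 3 → ℝ) (i j : Fin 3) : ℝ := v i * v j / ∑ l, v l ^ 2

theorem sum_sq_pos {v : Fin 3 → ℝ} (hv : v ≠ 0) : 0 < ∑ l, v l ^ 2 := by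
  obtain ⟨i, hi⟩ := Function.ne_iff.1 hv
  exact Finset.sum_pos' (fun _ _ => sq_nonneg _) ⟨i, Finset.mem_univ _, sq_pos_of_ne_zero hi⟩

theorem lineInvariant_smul {v : Fin 3 → ℝ} {c : ℝ} (hc : c ≠ 0) :
    lineInvariant (c • v) = lineInvariant v := by
  ext i j
  have : ∑ l, (c • v) l ^ 2 = c ^ 2 * ∑ l, v l ^ 2 := by
    rw [Finset.mul_sum]
    exact Finset.sum_congr rfl fun l _ => by simp only [Pi.smul_apply, smul_eq_mul]; ring
  rw [lineInvariant, lineInvariant, this]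
  simp only [Pi.smul_apply, smul_eq_mul]
  rw [← mul_div_mul_left (v i * v j) (∑ l, v l ^ 2) (pow_ne_zero 2 hc)]
  ring

theorem exists_smul_eq_of_lineInvariant_eq {v w : Fin 3 → ℝ} (hv : v ≠ 0) (hw : w ≠ 0)
    (h : lineInvariant v = lineInvariant w) : ∃ c : ℝ, c • w = v := by
  have hv' := sum_sq_pos hv
  have hw' := sum_sq_pos hw
  obtain ⟨i, hi⟩ := Function.ne_iff.1 hv
  rw [Pi.zero_apply] at hi
  -- The factor comes from row `i` of the two projection matrices, solved for `v j`.
  refine ⟨w i * (∑ l, v l ^ 2) / (v i * ∑ l, w l ^ 2), ?_⟩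
  ext j
  have hj := congrFun (congrFun h i) j
  simp only [lineInvariant] at hj
  rw [div_eq_div_iff hv'.ne' hw'.ne'] at hj
  rw [Pi.smul_apply, smul_eq_mul, div_mul_eq_mul_div, div_eq_iff (mul_ne_zero hi hw'.ne')]
  linarith

instance : T2Space RealProjectivePlane := by
  let f : RealProjectivePlane → Fin 3 → Fin 3 → ℝ :=
    Quotient.lift (fun v : {v : Fin 3 → ℝ // v ≠ 0} => lineInvariant v) <| by
      rintro ⟨v, hv⟩ ⟨w, hw⟩ h
      obtain ⟨c, rfl⟩ : ∃ c : ℝ, c • w = v := rpMk_eq_iff.1 (Quotient.sound h)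
      have hc : c ≠ 0 := by
        rintro rfl
        exact hv (zero_smul _ _)
      exact lineInvariant_smul hc
  refine T2Space.of_injective_continuous (f := f) ?_ ?_
  · intro a b h
    obtain ⟨v, hv, rfl⟩ := exists_rpMk_eq a
    obtain ⟨w, hw, rfl⟩ := exists_rpMk_eq b
    exact rpMk_eq_iff.2 (exists_smul_eq_of_lineInvariant_eq hv hw h)
  · refine Continuous.quotient_lift ?_ _
    refine continuous_pi fun i => continuous_pi fun j => ?_
    have hc (i : Fin 3) : Continuous fun v : {v : Fin 3 → ℝ // v ≠ 0} => v.1 i :=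
      (continuous_apply i).comp continuous_subtype_val
    exact ((hc i).mul (hc j)).div (continuous_finsetSum _ fun l _ => (hc l).pow 2)
      fun v => (sum_sq_pos v.2).ne'

/-! ### The projective plane as a box boundary modulo its centre -/

/-- The boundary of the box `[-k, k] × [-1, 1] × [-k, k]`. -/
def OnBox (k : ℕ) (v : Fin 3 → ℝ) : Prop :=
  |v 0| ≤ k ∧ |v 1| ≤ 1 ∧ |v 2| ≤ k ∧ (|v 0| = k ∨ |v 1| = 1 ∨ |v 2| = k)

/-- A factor of absolute value below `1` moves boundary points into the interior. Applied to `c` and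
`c⁻¹`, this shows that a line meets the boundary only in one antipodal pair. -/
theorem OnBox.one_le_of_smul {k : ℕ} (hk : 0 < k) {v : Fin 3 → ℝ} {c : ℝ} (hv : OnBox k v)
    (hcv : OnBox k (c • v)) : 1 ≤ |c| := by
  by_contra! hc
  have hkR : (0 : ℝ) < k := by exact_mod_cast hk
  obtain ⟨h0, h1, h2, -⟩ := hv
  obtain ⟨-, -, -, h⟩ := hcv
  simp only [Pi.smul_apply, smul_eq_mul, abs_mul] at h
  have hc0 := abs_nonneg c
  rcases h with h | h | h <;> nlinarith

theorem OnBox.eq_or_eq_neg {k : ℕ} (hk : 0 < k) {v w : Fin 3 → ℝ} {hv : v ≠ 0} {hw : w ≠ 0}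
    (hv' : OnBox k v) (hw' : OnBox k w) (h : rpMk v hv = rpMk w hw) : v = w ∨ v = -w := by
  obtain ⟨c, rfl⟩ := rpMk_eq_iff.1 h
  have h1 := OnBox.one_le_of_smul hk hw' hv'
  have hc : c ≠ 0 := by
    rintro rfl
    norm_num at h1
  have h2 : 1 ≤ |c⁻¹| := OnBox.one_le_of_smul hk hv' (by rwa [inv_smul_smul₀ hc])
  rw [abs_inv] at h2
  have h3 : |c| = 1 := le_antisymm ((one_le_inv₀ (by positivity)).1 h2) h1
  rcases eq_or_eq_neg_of_abs_eq h3 with rfl | rfl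
  · left
    simp
  · right
    simp

theorem exists_onBox {k : ℕ} (hk : 0 < k) (p : RealProjectivePlane) :
    ∃ v hv, OnBox k v ∧ rpMk v hv = p := by
  obtain ⟨v, hv, rfl⟩ := exists_rpMk_eq p
  have hkR : (0 : ℝ) < k := by exact_mod_cast hk
  -- This is the norm whose unit ball is the box; dividing by it puts the vector on the boundary.
  set N := max (|v 0| / k) (max |v 1| (|v 2| / k)) with hN
  have h0 : |v 0| / k ≤ N := le_max_left _ _
  have h1 : |v 1| ≤ N := (le_max_left _ _).trans (le_max_right _ _)
  have h2 : |v 2| / k ≤ N := (le_max_right _ _).trans (le_max_right _ _)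
  have hpos : 0 < N := by
    by_contra! hle
    apply hv
    ext i
    have e0 : |v 0| = 0 := le_antisymm (by
      have := (div_le_iff₀ hkR).1 (h0.trans hle)
      linarith) (abs_nonneg _)
    have e1 : |v 1| = 0 := le_antisymm (h1.trans hle) (abs_nonneg _)
    have e2 : |v 2| = 0 := le_antisymm (by
      have := (div_le_iff₀ hkR).1 (h2.trans hle)
      linarith) (abs_nonneg _)
    rw [abs_eq_zero] at e0 e1 e2
    fin_cases i <;> assumption
  rw [div_le_iff₀ hkR] at h0 h2
  have habs (i : Fin 3) : |(N⁻¹ • v) i| = |v i| / N := by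
    rw [Pi.smul_apply, smul_eq_mul, abs_mul, abs_of_pos (inv_pos.2 hpos)]
    field_simp
  refine ⟨N⁻¹ • v, smul_ne_zero (inv_ne_zero hpos.ne') hv, ⟨?_, ?_, ?_, ?_⟩,
    rpMk_eq_iff.2 ⟨N⁻¹, rfl⟩⟩
  · rw [habs, div_le_iff₀ hpos]
    linarith
  · rw [habs, div_le_iff₀ hpos]
    linarith
  · rw [habs, div_le_iff₀ hpos]
    linarith
  · rw [habs, habs, habs, div_eq_iff hpos.ne', div_eq_iff hpos.ne', div_eq_iff hpos.ne']
    rcases max_choice (|v 0| / k) (max |v 1| (|v 2| / k)) with h | h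
    · left
      rw [← hN, eq_div_iff hkR.ne'] at h
      linarith
    · rcases max_choice |v 1| (|v 2| / k) with h' | h'
      · right; left
        rw [← hN, h'] at h
        linarith
      · right; right
        rw [← hN, h', eq_div_iff hkR.ne'] at h
        linarith

/-- The point `(x, y, z)` of the box `[0, k] × [0, 1] × [0, k]`, after centering and scaling. -/
def boxVec (k : ℕ) (x y z : ℝ) : Fin 3 → ℝ := ![2 * x - k, 2 * y - 1, 2 * z - k]

theorem boxVec_eq_iff {k : ℕ} {x y z x' y' z' : ℝ} :
    boxVec k x y z = boxVec k x' y' z' ↔ x = x' ∧ y = y' ∧ z = z' := by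
  constructor
  · intro h
    have h0 := congrFun h 0
    have h1 := congrFun h 1
    have h2 := congrFun h 2
    simp only [boxVec, Matrix.cons_val] at h0 h1 h2
    exact ⟨by linarith, by linarith, by linarith⟩
  · rintro ⟨rfl, rfl, rfl⟩
    rfl

theorem neg_boxVec {k : ℕ} {x y z : ℝ} : -boxVec k x y z = boxVec k (k - x) (1 - y) (k - z) := by
  ext i
  fin_cases i <;> simp [boxVec] <;> ring

theorem onBox_boxVec {k : ℕ} {x y z : ℝ} (hx : x ∈ Set.Icc (0 : ℝ) k) (hy : y ∈ Set.Icc (0 : ℝ) 1)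
    (hz : z ∈ Set.Icc (0 : ℝ) k) (h : x = k ∨ y = 0 ∨ z = k) : OnBox k (boxVec k x y z) := by
  obtain ⟨hx0, hx1⟩ := hx
  obtain ⟨hy0, hy1⟩ := hy
  obtain ⟨hz0, hz1⟩ := hz
  simp only [OnBox, boxVec, Matrix.cons_val]
  refine ⟨abs_le.2 ⟨by linarith, by linarith⟩, abs_le.2 ⟨by linarith, by linarith⟩,
    abs_le.2 ⟨by linarith, by linarith⟩, ?_⟩
  rcases h with rfl | rfl | rfl
  · left
    rw [abs_of_nonneg] <;> linarith
  · right; left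
    norm_num
  · right; right
    rw [abs_of_nonneg] <;> linarith

theorem eq_boxVec (k : ℕ) (v : Fin 3 → ℝ) :
    v = boxVec k ((v 0 + k) / 2) ((v 1 + 1) / 2) ((v 2 + k) / 2) := by
  ext i
  fin_cases i <;> simp [boxVec] <;> ring

theorem boxVec_side_ne_zero {k : ℕ} (hk : 0 < k) (x z : ℝ) :
    boxVec k (min x k) (max (x - k) 0) z ≠ 0 := by
  intro h
  have hkR : (0 : ℝ) < k := by exact_mod_cast hk
  have h0 := congrFun h 0
  have h1 := congrFun h 1
  simp only [boxVec, Matrix.cons_val, Pi.zero_apply] at h0 h1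
  rcases le_total x k with h | h
  · rw [max_eq_right (by linarith)] at h1
    linarith
  · rw [min_eq_right h] at h0
    linarith

theorem boxVec_top_ne_zero {k : ℕ} (hk : 0 < k) (x y : ℝ) : boxVec k x y k ≠ 0 := by
  intro h
  have hkR : (0 : ℝ) < k := by exact_mod_cast hk
  have h2 := congrFun h 2
  simp only [boxVec, Matrix.cons_val, Pi.zero_apply] at h2
  linarith

/-- The chart of the drum running around the front and the right side of the box. -/
noncomputable def rpChart {k : ℕ} (hk : 0 < k) (p : ℝ × ℝ) : RealProjectivePlane :=
  rpMk (boxVec k (min p.1 k) (max (p.1 - k) 0) p.2) (boxVec_side_ne_zero hk p.1 p.2)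

/-- The chart of the top of the box. -/
noncomputable def rpTop {k : ℕ} (hk : 0 < k) (p : ℝ × ℝ) : RealProjectivePlane :=
  rpMk (boxVec k p.1 p.2 k) (boxVec_top_ne_zero hk p.1 p.2)

theorem continuous_boxVec {X : Type*} [TopologicalSpace X] {k : ℕ} {x y z : X → ℝ}
    (hx : Continuous x) (hy : Continuous y) (hz : Continuous z) :
    Continuous fun p => boxVec k (x p) (y p) (z p) := by
  refine continuous_pi fun i => ?_
  fin_cases i <;> simp only [boxVec, Fin.zero_eta, Fin.mk_one, Fin.reduceFinMk, Matrix.cons_val] <;>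
    fun_prop

theorem rpChart_continuous {k : ℕ} (hk : 0 < k) : Continuous (rpChart hk) :=
  continuous_rpMk (continuous_boxVec (by fun_prop) (by fun_prop) (by fun_prop)) _

theorem rpTop_continuous {k : ℕ} (hk : 0 < k) : Continuous (rpTop hk) :=
  continuous_rpMk (continuous_boxVec (by fun_prop) (by fun_prop) (by fun_prop)) _

theorem rpMk_boxVec_congr {k : ℕ} {x y z x' y' z' : ℝ} {h : boxVec k x y z ≠ 0}
    {h' : boxVec k x' y' z' ≠ 0} (hx : x = x') (hy : y = y') (hz : z = z') :
    rpMk (boxVec k x y z) h = rpMk (boxVec k x' y' z') h' := by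
  subst hx hy hz
  rfl

theorem rpMk_boxVec_opposite {k : ℕ} {x y z x' y' z' : ℝ} {h : boxVec k x y z ≠ 0}
    {h' : boxVec k x' y' z' ≠ 0} (hx : x + x' = k) (hy : y + y' = 1) (hz : z + z' = k) :
    rpMk (boxVec k x y z) h = rpMk (boxVec k x' y' z') h' := by
  refine rpMk_eq_iff.2 ⟨-1, ?_⟩
  rw [neg_one_smul, neg_boxVec, boxVec_eq_iff]
  exact ⟨by linarith, by linarith, by linarith⟩

theorem rpChart_glue {k : ℕ} (hk : 0 < k) (y : ℝ) :
    rpChart hk (k + 1, y) = rpChart hk (0, k - y) := by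
  refine rpMk_boxVec_opposite ?_ ?_ ?_ <;> simp

theorem rpTop_bottom {k : ℕ} (hk : 0 < k) {x : ℝ} (hx : x ≤ k) :
    rpTop hk (x, 0) = rpChart hk (x, k) := by
  refine rpMk_boxVec_congr ?_ ?_ ?_ <;> simp [hx]

/-- The front and right edges of the top border the chart directly. The back and left edges are
antipodal to the lower edges of the front and of the right side, hence lie in row `0`, run through
backwards. -/
theorem rpTop_top {k : ℕ} (hk : 0 < k) {x : ℝ} (hx : 0 ≤ x) :
    rpTop hk (x, 1) = rpChart hk (k - x, 0) := by
  refine rpMk_boxVec_opposite ?_ ?_ ?_ <;> simp [hx]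

theorem rpTop_left {k : ℕ} (hk : 0 < k) {y : ℝ} (hy : y ≤ 1) :
    rpTop hk (0, y) = rpChart hk (k + (1 - y), 0) := by
  refine rpMk_boxVec_opposite ?_ ?_ ?_ <;> simp [hy]

theorem rpTop_right {k : ℕ} (hk : 0 < k) {y : ℝ} (hy : 0 ≤ y) :
    rpTop hk (k, y) = rpChart hk (k + y, k) := by
  refine rpMk_boxVec_congr ?_ ?_ ?_ <;> simp [hy]

theorem onBox_side {k : ℕ} {x z : ℝ} (hx : x ∈ Set.Icc (0 : ℝ) (k + 1))
    (hz : z ∈ Set.Icc (0 : ℝ) k) : OnBox k (boxVec k (min x k) (max (x - k) 0) z) := by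
  have hk : (0 : ℝ) ≤ k := k.cast_nonneg
  refine onBox_boxVec ⟨le_min hx.1 hk, min_le_right _ _⟩
    ⟨le_max_right _ _, max_le (by linarith [hx.2]) zero_le_one⟩ hz ?_
  rcases le_total x k with h | h
  · exact Or.inr (Or.inl (max_eq_right (by linarith)))
  · exact Or.inl (min_eq_right h)

theorem rpChart_inj {k : ℕ} (hk : 0 < k) {x y x' y' : ℝ} (hx : x ∈ Set.Icc (0 : ℝ) (k + 1))
    (hy : y ∈ Set.Icc (0 : ℝ) k) (hx' : x' ∈ Set.Icc (0 : ℝ) (k + 1)) (hy' : y' ∈ Set.Icc (0 : ℝ) k)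
    (h : rpChart hk (x, y) = rpChart hk (x', y')) :
    (x = x' ∧ y = y') ∨ (x = 0 ∧ x' = k + 1) ∨ (x = k + 1 ∧ x' = 0) := by
  have hkR : (0 : ℝ) < k := by exact_mod_cast hk
  rcases OnBox.eq_or_eq_neg hk (onBox_side hx hy) (onBox_side hx' hy') h with h | h
  · obtain ⟨h1, h2, h3⟩ := boxVec_eq_iff.1 h
    refine Or.inl ⟨?_, h3⟩
    rcases le_total x k with h4 | h4 <;> rcases le_total x' k with h5 | h5 <;>
      simp only [h4, h5, min_eq_left, min_eq_right, sub_nonpos, sub_nonneg, max_eq_left,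
        max_eq_right] at h1 h2 <;> linarith
  -- The only antipodal points on front and right side lie on the left edge of the front and on the
  -- back edge of the right side, which form the seam.
  · rw [neg_boxVec] at h
    obtain ⟨h1, h2, h3⟩ := boxVec_eq_iff.1 h
    right
    rcases le_total x k with h4 | h4 <;> rcases le_total x' k with h5 | h5 <;>
      simp only [h4, h5, min_eq_left, min_eq_right, sub_nonpos, sub_nonneg, max_eq_left,
        max_eq_right] at h1 h2
    · linarith
    · exact Or.inl ⟨by linarith, by linarith⟩
    · exact Or.inr ⟨by linarith, by linarith⟩
    · linarith

theorem rpTop_inj {k : ℕ} (hk : 0 < k) {x y x' y' : ℝ} (hx : x ∈ Set.Icc (0 : ℝ) k)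
    (hy : y ∈ Set.Icc (0 : ℝ) 1) (hx' : x' ∈ Set.Icc (0 : ℝ) k) (hy' : y' ∈ Set.Icc (0 : ℝ) 1)
    (h : rpTop hk (x, y) = rpTop hk (x', y')) : x = x' ∧ y = y' := by
  have hkR : (0 : ℝ) < k := by exact_mod_cast hk
  have hkk : (k : ℝ) ∈ Set.Icc (0 : ℝ) k := ⟨hkR.le, le_rfl⟩
  rcases OnBox.eq_or_eq_neg hk (onBox_boxVec hx hy hkk (Or.inr (Or.inr rfl)))
    (onBox_boxVec hx' hy' hkk (Or.inr (Or.inr rfl))) h with h | h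
  · obtain ⟨h1, h2, -⟩ := boxVec_eq_iff.1 h
    exact ⟨h1, h2⟩
  · rw [neg_boxVec] at h
    obtain ⟨-, -, h3⟩ := boxVec_eq_iff.1 h
    linarith

theorem rpTop_ne_rpChart {k : ℕ} (hk : 0 < k) {x y x' y' : ℝ} (hx : x ∈ Set.Ioo (0 : ℝ) k)
    (hy : y ∈ Set.Ioo (0 : ℝ) 1) (hx' : x' ∈ Set.Icc (0 : ℝ) (k + 1))
    (hy' : y' ∈ Set.Icc (0 : ℝ) k) : rpTop hk (x, y) ≠ rpChart hk (x', y') := by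
  intro h
  have hkR : (0 : ℝ) < k := by exact_mod_cast hk
  have hkk : (k : ℝ) ∈ Set.Icc (0 : ℝ) k := ⟨hkR.le, le_rfl⟩
  obtain ⟨hx0, hx1⟩ := hx
  obtain ⟨hy0, hy1⟩ := hy
  rcases OnBox.eq_or_eq_neg hk (onBox_boxVec ⟨hx0.le, hx1.le⟩ ⟨hy0.le, hy1.le⟩ hkk
    (Or.inr (Or.inr rfl))) (onBox_side hx' hy') h with h | h
  · obtain ⟨h1, h2, -⟩ := boxVec_eq_iff.1 h
    rcases le_total x' k with h4 | h4
    · rw [max_eq_right (by linarith)] at h2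
      linarith
    · rw [min_eq_right h4] at h1
      linarith
  · rw [neg_boxVec] at h
    obtain ⟨h1, h2, -⟩ := boxVec_eq_iff.1 h
    rcases le_total x' k with h4 | h4
    · rw [max_eq_right (by linarith)] at h2
      linarith
    · rw [min_eq_right h4] at h1
      linarith

theorem exists_boxVec_eq {k : ℕ} (hk : 0 < k) (p : RealProjectivePlane) :
    ∃ x ∈ Set.Icc (0 : ℝ) k, ∃ y ∈ Set.Icc (0 : ℝ) 1, ∃ z ∈ Set.Icc (0 : ℝ) k,
      (x = k ∨ y = 0 ∨ z = k) ∧ ∃ h, rpMk (boxVec k x y z) h = p := by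
  obtain ⟨v, hv, ⟨h0, h1, h2, h⟩, rfl⟩ := exists_onBox hk p
  -- The right, front and top faces contain at least one point of each antipodal pair; otherwise
  -- pass to `-v`.
  wlog hs : v 0 = k ∨ v 1 = -1 ∨ v 2 = k generalizing v
  · rw [← rpMk_neg]
    have hneg (i : Fin 3) : |(-v) i| = |v i| := by rw [Pi.neg_apply, abs_neg]
    refine this (-v) _ (by rwa [hneg]) (by rwa [hneg]) (by rwa [hneg])
      (by rwa [hneg, hneg, hneg]) ?_
    push Not at hs
    simp only [Pi.neg_apply]
    rcases h with h | h | h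
    · exact Or.inl ((eq_or_eq_neg_of_abs_eq h).elim (fun h => absurd h hs.1) fun h => by linarith)
    · exact Or.inr (Or.inl ((eq_or_eq_neg_of_abs_eq h).elim (fun h => by linarith)
        fun h => absurd h hs.2.1))
    · exact Or.inr (Or.inr ((eq_or_eq_neg_of_abs_eq h).elim (fun h => absurd h hs.2.2)
        fun h => by linarith))
  rw [abs_le] at h0 h1 h2
  refine ⟨(v 0 + k) / 2, ⟨by linarith [h0.1], by linarith [h0.2]⟩, (v 1 + 1) / 2,
    ⟨by linarith [h1.1], by linarith [h1.2]⟩, (v 2 + k) / 2,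
    ⟨by linarith [h2.1], by linarith [h2.2]⟩, ?_, by rwa [← eq_boxVec], ?_⟩
  · rcases hs with h | h | h
    · exact Or.inl (by linarith)
    · exact Or.inr (Or.inl (by linarith))
    · exact Or.inr (Or.inr (by linarith))
  · congr 1
    exact (eq_boxVec k v).symm

theorem rpChart_or_rpTop {k : ℕ} (hk : 0 < k) (p : RealProjectivePlane) :
    (∃ x ∈ Set.Icc (0 : ℝ) (k + 1), ∃ y ∈ Set.Icc (0 : ℝ) k, rpChart hk (x, y) = p) ∨
    ∃ x ∈ Set.Ioo (0 : ℝ) k, ∃ y ∈ Set.Ioo (0 : ℝ) 1, rpTop hk (x, y) = p := by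
  obtain ⟨x, ⟨hx0, hx1⟩, y, ⟨hy0, hy1⟩, z, ⟨hz0, hz1⟩, h, hne, rfl⟩ := exists_boxVec_eq hk p
  have hkR : (0 : ℝ) < k := by exact_mod_cast hk
  by_cases c1 : y = 0
  · refine Or.inl ⟨x, ⟨hx0, by linarith⟩, z, ⟨hz0, hz1⟩, rpMk_boxVec_congr ?_ ?_ rfl⟩ <;>
      simp [hx1, c1]
  by_cases c2 : x = k
  · refine Or.inl ⟨k + y, ⟨by linarith, by linarith⟩, z, ⟨hz0, hz1⟩,
      rpMk_boxVec_congr ?_ ?_ rfl⟩ <;> simp [hy0, c2]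
  have c3 : z = k := by tauto
  subst c3
  rw [show rpMk (boxVec k x y k) hne = rpTop hk (x, y) from rfl]
  by_cases c4 : y = 1
  · subst c4
    rw [rpTop_top hk hx0]
    exact Or.inl ⟨k - x, ⟨by linarith, by linarith⟩, 0, ⟨le_rfl, hkR.le⟩, rfl⟩
  by_cases c5 : x = 0
  · subst c5
    rw [rpTop_left hk hy1]
    exact Or.inl ⟨k + (1 - y), ⟨by linarith, by linarith⟩, 0, ⟨le_rfl, hkR.le⟩, rfl⟩
  exact Or.inr ⟨x, ⟨lt_of_le_of_ne hx0 (Ne.symm c5), lt_of_le_of_ne hx1 c2⟩, y,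
    ⟨lt_of_le_of_ne hy0 (Ne.symm c1), lt_of_le_of_ne hy1 c4⟩, rfl⟩

/-- The top of the box is filled by edges and squares running from front to back. -/
noncomputable def rpFilling (k : ℕ) (hk : 2 ≤ k) :
    DrumFilling k (extraZ k) RealProjectivePlane (Fin (k - 1)) (Fin k) where
  chart := rpChart (by omega : 0 < k)
  chart_continuous := rpChart_continuous _
  chart_glue y _ := rpChart_glue _ y
  chart_inj _ _ _ _ hx hy hx' hy' h := rpChart_inj _ hx hy hx' hy' h
  src a := drumMk k (Fin.last k) ⟨a + 1, by omega⟩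
  tgt a := drumMk k 0 ⟨k - (a + 1), by omega⟩
  arc a t := rpTop (by omega : 0 < k) ((a.val + 1 : ℕ), t)
  face a z := rpTop (by omega : 0 < k) (a.val + z.1, z.2)
  arc_continuous a := (rpTop_continuous (by omega : 0 < k)).comp (by fun_prop)
  face_continuous a := (rpTop_continuous (by omega : 0 < k)).comp (by fun_prop)
  arc_zero a := by
    have ha : a.val + 1 ≤ k := by omega
    rw [drumPoint_mk_of_le _ _ (by exact ha), rpTop_bottom _ (by exact_mod_cast ha)]
    simp
  arc_one a := by
    have ha : a.val + 1 ≤ k := by omega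
    rw [drumPoint_mk_of_le _ _ (by simp only; omega), rpTop_top _ (Nat.cast_nonneg _)]
    simp only [Nat.cast_sub ha, Fin.val_zero, Nat.cast_zero]
  exists_adj a := by
    refine ⟨⟨a + 1 + (k + 1), by omega⟩, ⟨k - (a + 1), by omega⟩, ?_, ?_⟩
    · rw [extraZ, SimpleGraph.fromRel_adj]
      refine ⟨?_, Or.inl ?_⟩
      · rw [Ne, Fin.mk.injEq]
        omega
      · simp only
        omega
    · refine congrArg₂ (fun u v => s(u, v)) ?_ rfl
      rw [drumMk_eq_iff]
      simp
  exists_edge a b hab := by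
    rw [extraZ, SimpleGraph.fromRel_adj, Ne, Fin.ext_iff] at hab
    rw [drumGraph_adj_iff]
    wlog hlt : a.val < b.val generalizing a b
    · rcases this b a (by omega) (by omega) with h | ⟨e, he⟩
      · left
        simp only [and_true] at h ⊢
        omega
      · exact Or.inr ⟨e, he.trans Sym2.eq_swap⟩
    simp only [and_true]
    -- The two end rungs of the ladder are the cycle edges from `0` to `2k+1` and from `k` to `k +
    -- 1`.
    by_cases h : a.val = 0 ∨ a.val = k
    · left
      right
      omega
    · right
      refine ⟨⟨k - 1 - a, by omega⟩, ?_⟩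
      simp only [Sym2.eq_iff, drumMk_eq_iff, Fin.val_last, Fin.val_zero, true_and]
      omega
  edge_injective := by
    intro a b h
    simp only [Sym2.eq_iff, drumMk_eq_iff, Fin.val_last, Fin.val_zero] at h
    ext
    omega
  edge_ne d a h := by
    rcases d with ⟨⟨c, hc⟩, ⟨d, hd⟩⟩ | ⟨⟨c, hc⟩, ⟨d, hd⟩⟩ <;>
    simp only [drumSrc, drumTgt, Sym2.eq_iff, drumMk_eq_iff, Fin.val_last, Fin.val_zero,
      Fin.val_castSucc, Fin.val_succ] at h <;> omega
  side_bottom a := by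
    have ha : (a.val : ℝ) + 1 ≤ k := by exact_mod_cast a.2
    refine ⟨.inl (.inl (a.castSucc, Fin.last k)), Or.inl fun t ht => ?_⟩
    simp only
    rw [rpTop_bottom _ (by linarith [ht.2])]
    simp [drumArc]
  side_right a := by
    by_cases h : a.val + 1 = k
    · have ha : (a.val : ℝ) + 1 = k := by exact_mod_cast h
      refine ⟨.inl (.inl (Fin.last k, Fin.last k)), Or.inl fun t ht => ?_⟩
      simp only [ha]
      rw [rpTop_right _ ht.1]
      simp [drumArc]
    · exact ⟨.inr ⟨a, by omega⟩, Or.inl fun t _ => by simp⟩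
  side_top a := by
    have ha : a.val + 1 ≤ k := a.2
    refine ⟨.inl (.inl (⟨k - (a + 1), by omega⟩, 0)), Or.inr fun t ht => ?_⟩
    simp only
    rw [rpTop_top _ (add_nonneg (Nat.cast_nonneg _) ht.1)]
    simp only [drumArc, Sum.elim_inl, Nat.cast_sub ha, Fin.val_zero, Nat.cast_zero]
    congr 2
    push_cast
    ring
  side_left a := by
    by_cases h : a.val = 0
    · refine ⟨.inl (.inl (Fin.last k, 0)), Or.inr fun t ht => ?_⟩
      simp only [h, Nat.cast_zero, add_zero]
      rw [rpTop_left _ ht.2]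
      simp [drumArc]
    · refine ⟨.inr ⟨a - 1, by omega⟩, Or.inl fun t _ => ?_⟩
      simp only [Sum.elim_inr, add_zero, Nat.sub_add_cancel (Nat.one_le_iff_ne_zero.2 h)]
  face_injOn a := by
    rintro ⟨s, t⟩ ⟨hs, ht⟩ ⟨s', t'⟩ ⟨hs', ht'⟩ h
    simp only at hs ht hs' ht'
    have ha : (a.val : ℝ) + 1 ≤ k := by exact_mod_cast a.2
    have ha0 : (0 : ℝ) ≤ a.val := Nat.cast_nonneg _
    obtain ⟨h1, h2⟩ := rpTop_inj _ ⟨by linarith [hs.1], by linarith [hs.2]⟩ ht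
      ⟨by linarith [hs'.1], by linarith [hs'.2]⟩ ht' h
    exact Prod.ext (by simp only; linarith) h2
  arc_ne_chart a t x y ht hx hy := by
    have ha : a.val + 1 < k := by omega
    exact rpTop_ne_rpChart _ ⟨by positivity, by exact_mod_cast ha⟩ ht hx hy
  face_ne_chart a z x y hz hx hy := by
    have ha : (a.val : ℝ) + 1 ≤ k := by exact_mod_cast a.2
    exact rpTop_ne_rpChart _ ⟨add_pos_of_nonneg_of_pos (Nat.cast_nonneg _) hz.1.1,
      by linarith [hz.1.2]⟩ hz.2 hx hy
  face_ne_arc a z b t hz ht h := by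
    have ha : (a.val : ℝ) + 1 ≤ k := by exact_mod_cast a.2
    have hb : b.val + 1 ≤ k := by omega
    obtain ⟨h1, -⟩ := rpTop_inj _ ⟨add_nonneg (Nat.cast_nonneg _) hz.1.1.le,
      by linarith [hz.1.2]⟩ (Set.Ioo_subset_Icc_self hz.2) ⟨Nat.cast_nonneg _,
      by exact_mod_cast hb⟩ (Set.Ioo_subset_Icc_self ht) h
    rw [← add_zero ((b.val + 1 : ℕ) : ℝ)] at h1
    exact hz.1.1.ne' (natCast_add_inj (Set.Ioo_subset_Ico_self hz.1) ⟨le_rfl, one_pos⟩ h1).2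
  arc_inj a b t t' ht ht' h := by
    have ha : a.val + 1 ≤ k := by omega
    have hb : b.val + 1 ≤ k := by omega
    obtain ⟨h1, h2⟩ := rpTop_inj _ ⟨Nat.cast_nonneg _, by exact_mod_cast ha⟩
      (Set.Ioo_subset_Icc_self ht) ⟨Nat.cast_nonneg _, by exact_mod_cast hb⟩
      (Set.Ioo_subset_Icc_self ht') h
    have h3 : a.val + 1 = b.val + 1 := by exact_mod_cast h1
    exact ⟨Fin.ext (by omega), h2⟩
  face_inj a b z z' hz hz' h := by
    have ha : (a.val : ℝ) + 1 ≤ k := by exact_mod_cast a.2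
    have hb : (b.val : ℝ) + 1 ≤ k := by exact_mod_cast b.2
    obtain ⟨h1, -⟩ := rpTop_inj _ ⟨add_nonneg (Nat.cast_nonneg _) hz.1.1.le,
      by linarith [hz.1.2]⟩ (Set.Ioo_subset_Icc_self hz.2)
      ⟨add_nonneg (Nat.cast_nonneg _) hz'.1.1.le, by linarith [hz'.1.2]⟩
      (Set.Ioo_subset_Icc_self hz'.2) h
    exact Fin.ext (natCast_add_inj (Set.Ioo_subset_Ico_self hz.1)
      (Set.Ioo_subset_Ico_self hz'.1) h1).1
  cover p := by
    rcases rpChart_or_rpTop (by omega : 0 < k) p with h | ⟨x, hx, y, hy, rfl⟩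
    · exact Or.inl h
    · right
      obtain ⟨a, s, hs, rfl⟩ := exists_natCast_add hx.1.le
      have ha : a < k := by
        have : (a : ℝ) < k := by linarith [hs.1, hx.2]
        exact_mod_cast this
      rcases hs.1.eq_or_lt with rfl | hs0
      · have ha0 : 0 < a := by
          have := hx.1
          rw [add_zero] at this
          exact_mod_cast this
        refine Or.inl ⟨⟨a - 1, by omega⟩, y, hy, ?_⟩
        simp only [Nat.sub_add_cancel ha0, add_zero]
      · exact Or.inr ⟨⟨a, ha⟩, (s, y), ⟨⟨hs0, hs.2⟩, hy⟩, rfl⟩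

theorem graphZ_quadrangulates {k : ℕ} (hk : 2 ≤ k) :
    Quadrangulates (graphZ k) RealProjectivePlane :=
  (rpFilling k hk).quadrangulates hk

/-! ### The vertices of the Schrijver graph -/

/-- The successor of a position on the cycle. -/
def cycSucc {k : ℕ} (m : Fin (2 * k + 2)) : Fin (2 * k + 2) :=
  ⟨if m.val + 1 < 2 * k + 2 then m.val + 1 else 0, by split_ifs <;> omega⟩

theorem cycSucc_injective {k : ℕ} : Function.Injective (cycSucc (k := k)) := by
  intro a b h
  have h' := congrArg Fin.val h
  simp only [cycSucc] at h'
  ext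
  split_ifs at h' <;> omega

theorem isIndepSet_cycleGraph_iff {k : ℕ} {s : Set (Fin (2 * k + 2))} :
    (SimpleGraph.cycleGraph (2 * k + 2)).IsIndepSet s ↔ ∀ m ∈ s, cycSucc m ∉ s := by
  have hval (m : Fin (2 * k + 2)) : (cycSucc m).val =
    if m.val + 1 < 2 * k + 2 then m.val + 1 else 0 := rfl
  constructor
  · intro h m hm hm'
    refine h hm hm' (fun he => ?_) ?_
    · have := congrArg Fin.val he
      rw [hval] at this
      split_ifs at this <;> omega
    · rw [cycleGraph_adj_iff_val, hval]
      split_ifs <;> omega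
  · intro h a ha b hb _ hadj
    rw [cycleGraph_adj_iff_val] at hadj
    have key (a b : Fin (2 * k + 2)) (ha : a ∈ s) (hb : b ∈ s)
        (hab : b.val = a.val + 1 ∨ (b.val = 0 ∧ a.val = 2 * k + 1)) : False := by
      have : cycSucc a = b := by
        ext
        rw [hval]
        split_ifs <;> omega
      exact h a ha (this ▸ hb)
    rcases hadj with h' | h' | h' | h'
    · exact key a b ha hb (Or.inl h')
    · exact key b a hb ha (Or.inl h')
    · exact key b a hb ha (Or.inr h')
    · exact key a b ha hb (Or.inr h')

/-- The positions that neither lie in `s` nor are followed by an element of `s`. -/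
def breaks {k : ℕ} (s : Finset (Fin (2 * k + 2))) : Finset (Fin (2 * k + 2)) :=
  Finset.univ.filter fun m => m ∉ s ∧ cycSucc m ∉ s

/-- The set, the predecessors of its elements and the breaks partition the cycle, and the first two
have the same size. -/
theorem two_mul_card_add_card_breaks {k : ℕ} {s : Finset (Fin (2 * k + 2))}
    (h : ∀ m ∈ s, cycSucc m ∉ s) : 2 * s.card + (breaks s).card = 2 * k + 2 := by
  have h1 : (Finset.univ.filter fun m => cycSucc m ∈ s).card = s.card := by
    refine Finset.card_bij (fun m _ => cycSucc m) (fun m hm => (Finset.mem_filter.1 hm).2)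
      (fun a _ b _ hab => cycSucc_injective hab) fun b hb => ?_
    obtain ⟨a, rfl⟩ := Finite.injective_iff_surjective.1 cycSucc_injective b
    exact ⟨a, by simpa using hb, rfl⟩
  have h2 : Disjoint s (Finset.univ.filter fun m => cycSucc m ∈ s) :=
    Finset.disjoint_left.2 fun m hm hm' => h m hm (Finset.mem_filter.1 hm').2
  have h3 : breaks s = (s ∪ Finset.univ.filter fun m => cycSucc m ∈ s)ᶜ := by
    ext m
    simp [breaks]
  have h4 := Finset.card_compl_add_card (s ∪ Finset.univ.filter fun m => cycSucc m ∈ s)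
  rw [← h3, Finset.card_union_of_disjoint h2, h1, Fintype.card_fin] at h4
  omega

/-- The clockwise distance from position `j - i` to position `m`. -/
def rotVal (k i j m : ℕ) : ℕ :=
  if j ≤ m + i then if m + i - j < 2 * k + 2 then m + i - j else m + i - j - (2 * k + 2)
  else m + i + (2 * k + 2) - j

/-- The stable set assigned to the vertex in row `i` at position `j`. -/
def stableSet (k : ℕ) (i : Fin (k + 1)) (j : Fin (2 * k + 2)) : Finset (Fin (2 * k + 2)) :=
  Finset.univ.filter fun m =>
    (rotVal k i j m % 2 = 0 ∧ 2 ≤ rotVal k i j m ∧ rotVal k i j m ≤ 2 * i.val) ∨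
      (rotVal k i j m % 2 = 1 ∧ 2 * i.val + 3 ≤ rotVal k i j m)

theorem mem_stableSet {k : ℕ} {i : Fin (k + 1)} {j m : Fin (2 * k + 2)} :
    m ∈ stableSet k i j ↔
      (rotVal k i j m % 2 = 0 ∧ 2 ≤ rotVal k i j m ∧ rotVal k i j m ≤ 2 * i.val) ∨
      (rotVal k i j m % 2 = 1 ∧ 2 * i.val + 3 ≤ rotVal k i j m) := by
  simp [stableSet]

theorem rotVal_spec {k i j m : ℕ} (hi : i ≤ k) (hj : j < 2 * k + 2) (hm : m < 2 * k + 2) :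
    rotVal k i j m < 2 * k + 2 ∧ (rotVal k i j m + j = m + i ∨
      rotVal k i j m + j + (2 * k + 2) = m + i ∨ rotVal k i j m + j = m + i + (2 * k + 2)) := by
  unfold rotVal
  split_ifs <;> omega

/-- Measured from the break `j - i`, the set consists of the even distances `2, …, 2i` and the odd
distances `2i + 3, …, 2k + 1`; the gap at `2i + 1` and the missing distance `0` separate the two
runs. -/
theorem stableSet_succ_notMem {k : ℕ} (i : Fin (k + 1)) (j : Fin (2 * k + 2)) :
    ∀ m ∈ stableSet k i j, cycSucc m ∉ stableSet k i j := by
  intro m hm hm'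
  rw [mem_stableSet] at hm hm'
  have h1 := rotVal_spec (Nat.lt_succ_iff.1 i.2) j.2 m.2
  have h2 := rotVal_spec (Nat.lt_succ_iff.1 i.2) j.2 (cycSucc m).2
  have h3 : (cycSucc m).val = if m.val + 1 < 2 * k + 2 then m.val + 1 else 0 := rfl
  have := m.2
  split_ifs at h3 <;> omega

/-- The first break of a stable set. -/
def breakFst (k : ℕ) (i : Fin (k + 1)) (j : Fin (2 * k + 2)) : Fin (2 * k + 2) :=
  ⟨if i.val ≤ j.val then j - i else j + (2 * k + 2) - i, by split_ifs <;> omega⟩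

/-- The second break of a stable set. -/
def breakSnd (k : ℕ) (i : Fin (k + 1)) (j : Fin (2 * k + 2)) : Fin (2 * k + 2) :=
  ⟨if j.val + i.val + 1 < 2 * k + 2 then j + i + 1 else j + i + 1 - (2 * k + 2), by
    split_ifs <;> omega⟩

theorem breakFst_spec {k : ℕ} (i : Fin (k + 1)) (j : Fin (2 * k + 2)) :
    (breakFst k i j).val + i = j ∨ (breakFst k i j).val + i = j + (2 * k + 2) := by
  simp only [breakFst]
  split_ifs <;> omega

theorem breakSnd_spec {k : ℕ} (i : Fin (k + 1)) (j : Fin (2 * k + 2)) :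
    (breakSnd k i j).val = j + i + 1 ∨ (breakSnd k i j).val + (2 * k + 2) = j + i + 1 := by
  simp only [breakSnd]
  split_ifs <;> omega

theorem breakFst_ne_breakSnd {k : ℕ} (i : Fin (k + 1)) (j : Fin (2 * k + 2)) :
    breakFst k i j ≠ breakSnd k i j := by
  rw [Ne, Fin.ext_iff]
  have := breakFst_spec i j
  have := breakSnd_spec i j
  omega

theorem breaks_stableSet {k : ℕ} (i : Fin (k + 1)) (j : Fin (2 * k + 2)) :
    breaks (stableSet k i j) = {breakFst k i j, breakSnd k i j} := by
  ext m
  simp only [breaks, Finset.mem_filter, Finset.mem_univ, true_and, mem_stableSet,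
    Finset.mem_insert, Finset.mem_singleton, Fin.ext_iff]
  have h1 := rotVal_spec (Nat.lt_succ_iff.1 i.2) j.2 m.2
  have h2 := rotVal_spec (Nat.lt_succ_iff.1 i.2) j.2 (cycSucc m).2
  have h3 : (cycSucc m).val = if m.val + 1 < 2 * k + 2 then m.val + 1 else 0 := rfl
  have h4 := breakFst_spec i j
  have h5 := breakSnd_spec i j
  have := m.2
  have := (breakFst k i j).2
  have := (breakSnd k i j).2
  generalize rotVal k i j m = r at *
  generalize rotVal k i j (cycSucc m) = r' at *
  have h6 : r' = r + 1 ∨ (r = 2 * k + 1 ∧ r' = 0) := by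
    split_ifs at h3 <;> omega
  have h7 : m.val = (breakFst k i j).val ↔ r = 0 := by omega
  have h8 : m.val = (breakSnd k i j).val ↔ r = 2 * i.val + 1 := by omega
  rw [h7, h8]
  omega

theorem card_stableSet {k : ℕ} (i : Fin (k + 1)) (j : Fin (2 * k + 2)) :
    (stableSet k i j).card = k := by
  have h := two_mul_card_add_card_breaks (stableSet_succ_notMem i j)
  rw [breaks_stableSet, Finset.card_pair (breakFst_ne_breakSnd i j)] at h
  omega

/-- Distances are now measured from the other break. The shift by the odd number `2i + 1` exchanges
the even and the odd run. -/
theorem stableSet_eq_of_opposite {k : ℕ} {i i' : Fin (k + 1)} {j j' : Fin (2 * k + 2)}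
    (h : i.val + i'.val = k) (h' : j'.val = j.val + (k + 1)) :
    stableSet k i j = stableSet k i' j' := by
  ext m
  rw [mem_stableSet, mem_stableSet]
  have h1 := rotVal_spec (Nat.lt_succ_iff.1 i.2) j.2 m.2
  have h2 := rotVal_spec (Nat.lt_succ_iff.1 i'.2) j'.2 m.2
  have := m.2
  generalize rotVal k i j m = r at *
  generalize rotVal k i' j' m = r' at *
  have h3 : r = r' + (2 * i.val + 1) ∨ r + (2 * k + 2) = r' + (2 * i.val + 1) := by omega
  omega

/-- The vertex of the Schrijver graph assigned to a vertex of the reduced drum. -/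
def drumStable (k : ℕ) : DrumVertex k → schrijverSet (2 * k + 2) k :=
  Quotient.lift (fun p : Fin (k + 1) × Fin (2 * k + 2) =>
    ⟨⟨stableSet k p.1 p.2, card_stableSet p.1 p.2⟩, isIndepSet_cycleGraph_iff.2 fun m hm hm' =>
      stableSet_succ_notMem p.1 p.2 m hm hm'⟩) <| by
    rintro p q (rfl | ⟨h, h' | h'⟩)
    · rfl
    · exact Subtype.ext (Subtype.ext (stableSet_eq_of_opposite h h'))
    · exact Subtype.ext (Subtype.ext (stableSet_eq_of_opposite (by omega) h').symm)

theorem drumStable_drumMk {k : ℕ} (i : Fin (k + 1)) (j : Fin (2 * k + 2)) :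
    (drumStable k (drumMk k i j)).1.1 = stableSet k i j := rfl

/-- The two breaks are recovered from the set. If they match in order the vertices coincide, if they
match crosswise the vertices are opposite. -/
theorem drumStable_injective (k : ℕ) : Function.Injective (drumStable k) := by
  intro u v h
  obtain ⟨i, j, -, rfl⟩ := exists_drumMk_eq u
  obtain ⟨i', j', -, rfl⟩ := exists_drumMk_eq v
  have h' : stableSet k i j = stableSet k i' j' := congrArg (fun s => s.1.1) h
  have hb := breaks_stableSet i j
  rw [h', breaks_stableSet i' j'] at hb
  have e1 : breakFst k i j ∈ ({breakFst k i' j', breakSnd k i' j'} : Finset _) := by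
    rw [hb]
    simp
  have e2 : breakSnd k i j ∈ ({breakFst k i' j', breakSnd k i' j'} : Finset _) := by
    rw [hb]
    simp
  simp only [Finset.mem_insert, Finset.mem_singleton, Fin.ext_iff] at e1 e2
  have hne := breakFst_ne_breakSnd i j
  rw [Ne, Fin.ext_iff] at hne
  have h1 := breakFst_spec i j
  have h2 := breakSnd_spec i j
  have h3 := breakFst_spec i' j'
  have h4 := breakSnd_spec i' j'
  rw [drumMk_eq_iff]
  rcases e1 with e1 | e1 <;> rcases e2 with e2 | e2 <;> omega

theorem drumStable_surjective (k : ℕ) : Function.Surjective (drumStable k) := by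
  rintro ⟨⟨s, hcard⟩, hs⟩
  replace hs : ∀ m ∈ s, cycSucc m ∉ s := isIndepSet_cycleGraph_iff.1 hs
  have hb := two_mul_card_add_card_breaks hs
  obtain ⟨x, y, hxy, hbr⟩ := Finset.card_eq_two.1 (show (breaks s).card = 2 by omega)
  wlog hlt : x.val < y.val generalizing x y
  · refine this y x hxy.symm (by rw [hbr, Finset.pair_comm]) ?_
    rw [Ne, Fin.ext_iff] at hxy
    omega
  have hbreak (m : Fin (2 * k + 2)) : (m ∉ s ∧ cycSucc m ∉ s) ↔ m = x ∨ m = y := by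
    have := congrArg (m ∈ ·) hbr
    simpa [breaks] using this
  have hx := (hbreak x).2 (Or.inl rfl)
  have hy := (hbreak y).2 (Or.inr rfl)
  have hstep (m : Fin (2 * k + 2)) (h1 : m ≠ x) (h2 : m ≠ y) : cycSucc m ∈ s ↔ m ∉ s := by
    refine ⟨fun h h' => hs m h' h, fun h => ?_⟩
    by_contra hc
    rcases (hbreak m).1 ⟨h, hc⟩ with h | h
    · exact h1 h
    · exact h2 h
  have hsucc (m : ℕ) (h : m + 1 < 2 * k + 2) :
      cycSucc (⟨m, by omega⟩ : Fin (2 * k + 2)) = ⟨m + 1, h⟩ := by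
    ext
    exact if_pos h
  have hlast : cycSucc (⟨2 * k + 1, by omega⟩ : Fin (2 * k + 2)) = ⟨0, by omega⟩ := by
    ext
    exact if_neg (by simp)
  -- Membership alternates along each of the two arcs between the breaks. The arc from `y` back to
  -- `x` passes through `0` and is treated in two pieces.
  have claim1 (m : ℕ) (hm : m < 2 * k + 2) (h1 : x.val < m) (h2 : m ≤ y.val) :
      (⟨m, hm⟩ : Fin (2 * k + 2)) ∈ s ↔ (m - x.val) % 2 = 0 := by
    induction m with
    | zero => omega
    | succ m ih =>
      rw [← hsucc m hm]
      by_cases hmx : m = x.val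
      · subst hmx
        exact iff_of_false hx.2 (by omega)
      · rw [hstep _ (by rw [Ne, Fin.ext_iff]; exact hmx) (by rw [Ne, Fin.ext_iff]; simp only; omega),
          ih (by omega) (by omega) (by omega)]
        omega
  have claim2 (m : ℕ) (hm : m < 2 * k + 2) (h1 : y.val < m) :
      (⟨m, hm⟩ : Fin (2 * k + 2)) ∈ s ↔ (m - y.val) % 2 = 0 := by
    induction m with
    | zero => omega
    | succ m ih =>
      rw [← hsucc m hm]
      by_cases hmy : m = y.val
      · subst hmy
        exact iff_of_false hy.2 (by omega)
      · rw [hstep _ (by rw [Ne, Fin.ext_iff]; simp only; omega) (by rw [Ne, Fin.ext_iff]; exact hmy),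
          ih (by omega) (by omega)]
        omega
  have claim3 (m : ℕ) (hm : m < 2 * k + 2) (h1 : m ≤ x.val) :
      (⟨m, hm⟩ : Fin (2 * k + 2)) ∈ s ↔ (m + (2 * k + 2) - y.val) % 2 = 0 := by
    induction m with
    | zero =>
      rw [← hlast]
      by_cases hmy : 2 * k + 1 = y.val
      · have : y = ⟨2 * k + 1, by omega⟩ := Fin.ext hmy.symm
        rw [← this]
        exact iff_of_false hy.2 (by omega)
      · rw [hstep _ (by rw [Ne, Fin.ext_iff]; simp only; omega) (by rw [Ne, Fin.ext_iff]; exact hmy),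
          claim2 _ _ (by omega)]
        omega
    | succ m ih =>
      rw [← hsucc m hm, hstep _ (by rw [Ne, Fin.ext_iff]; simp only; omega)
        (by rw [Ne, Fin.ext_iff]; simp only; omega), ih (by omega) (by omega)]
      omega
  -- The break `y` is outside `s`. The distance is therefore `2i + 1`, and `x = j - i` yields the
  -- row and the position.
  have hodd : (y.val - x.val) % 2 = 1 := by
    have := (claim1 y.val y.2 hlt le_rfl).not.1 hy.1
    omega
  refine ⟨drumMk k ⟨(y.val - x.val) / 2, by omega⟩ ⟨x.val + (y.val - x.val) / 2, by omega⟩,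
    Subtype.ext (Subtype.ext ?_)⟩
  rw [drumStable_drumMk]
  ext m
  rw [mem_stableSet]
  have h1 := rotVal_spec (k := k) (i := (y.val - x.val) / 2) (j := x.val + (y.val - x.val) / 2)
    (m := m.val) (by omega) (by omega) m.2
  simp only
  generalize rotVal k ((y.val - x.val) / 2) (x.val + (y.val - x.val) / 2) m.val = r at *
  have := m.2
  rcases le_or_gt m.val x.val with h | h
  · rw [show m ∈ s ↔ _ from claim3 m.val m.2 h]
    omega
  · rcases le_or_gt m.val y.val with h' | h'
    · rw [show m ∈ s ↔ _ from claim1 m.val m.2 h h']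
      omega
    · rw [show m ∈ s ↔ _ from claim2 m.val m.2 h']
      omega

/-! ### Edges of the drum and of the bottom row in the Schrijver graph -/

theorem schrijverGraph_adj_of_disjoint {k : ℕ} (hk : 2 ≤ k) {u v : DrumVertex k}
    (h : Disjoint (drumStable k u).1.1 (drumStable k v).1.1) :
    (schrijverGraph (2 * k + 2) k).Adj (drumStable k u) (drumStable k v) := by
  refine ⟨fun he => ?_, h⟩
  replace he : (drumStable k u).1 = (drumStable k v).1 := he
  rw [he, disjoint_self, Finset.bot_eq_empty] at h
  have := (drumStable k v).1.2
  rw [h, Finset.card_empty] at this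
  omega

/-- A horizontal edge rotates the independent set by one step. A vertical edge moves the two breaks
apart by one step each, which switches the parity class on both arcs. -/
theorem disjoint_of_drumEdge {k : ℕ} (e : DrumEdge k) :
    Disjoint (drumStable k (drumSrc k e)).1.1 (drumStable k (drumTgt k e)).1.1 := by
  rcases e with ⟨⟨a, ha⟩, ⟨b, hb⟩⟩ | ⟨⟨a, ha⟩, ⟨b, hb⟩⟩ <;>
  simp only [drumSrc, drumTgt, drumStable_drumMk, Finset.disjoint_left, mem_stableSet,
    Fin.val_castSucc, Fin.val_succ] <;> intro m
  · have h1 := rotVal_spec (k := k) (i := b) (j := a) (by omega) (by omega) m.2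
    have h2 := rotVal_spec (k := k) (i := b) (j := a + 1) (by omega) (by omega) m.2
    omega
  · have h1 := rotVal_spec (k := k) (i := b) (j := a) (by omega) (by omega) m.2
    have h2 := rotVal_spec (k := k) (i := b + 1) (j := a) (by omega) (by omega) m.2
    omega

/-- In row `0` only odd distances from the position occur, and the cycle has even length, so
positions of different parity give sets in different parity classes. -/
theorem disjoint_of_bottomRow {k : ℕ} {a b : Fin (2 * k + 2)} (h : (a.val + b.val) % 2 = 1) :
    Disjoint (drumStable k (drumMk k 0 a)).1.1 (drumStable k (drumMk k 0 b)).1.1 := by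
  simp only [drumStable_drumMk, Finset.disjoint_left, mem_stableSet, Fin.val_zero]
  intro m
  have h1 := rotVal_spec (k := k) (i := 0) (j := a) (by omega) a.2 m.2
  have h2 := rotVal_spec (k := k) (i := 0) (j := b) (by omega) b.2 m.2
  omega

theorem drumWith_le_comap {k : ℕ} (hk : 2 ≤ k) {B : SimpleGraph (Fin (2 * k + 2))}
    (hB : ∀ a b, B.Adj a b → (a.val + b.val) % 2 = 1) :
    drumWith k B ≤ (schrijverGraph (2 * k + 2) k).comap (drumStable k) := by
  intro u v h
  rw [drumWith_adj_iff hk] at h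
  rw [← SimpleGraph.mem_edgeSet]
  rcases h with ⟨e, he⟩ | ⟨a, b, hab, he⟩
  · rw [← he]
    exact schrijverGraph_adj_of_disjoint hk (disjoint_of_drumEdge e)
  · rw [← he]
    exact schrijverGraph_adj_of_disjoint hk (disjoint_of_bottomRow (hB a b hab))

theorem extraY_adj_odd {k : ℕ} (a b : Fin (2 * k + 2)) (h : (extraY k).Adj a b) :
    (a.val + b.val) % 2 = 1 := by
  rw [extraY, SimpleGraph.fromRel_adj, Nat.even_iff, Nat.odd_iff] at h
  omega

theorem extraZ_adj_odd {k : ℕ} (a b : Fin (2 * k + 2)) (h : (extraZ k).Adj a b) :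
    (a.val + b.val) % 2 = 1 := by
  rw [extraZ, SimpleGraph.fromRel_adj] at h
  omega

/-- The only extra edge at position `0` leads to `2k + 1`, a neighbour on the cycle already. In
`Y_k` position `0` is joined to `k + 1` or `k`, which separates the graphs. -/
theorem not_graphZ_adj {k : ℕ} (hk : 2 ≤ k) {c : Fin (2 * k + 2)} (h1 : 2 ≤ c.val)
    (h2 : c.val ≤ 2 * k) : ¬(graphZ k).Adj (drumMk k 0 0) (drumMk k 0 c) := by
  intro h
  rw [graphZ, drumWith_adj_iff hk] at h
  rcases h with ⟨⟨⟨a, ha⟩, ⟨b, hb⟩⟩ | ⟨⟨a, ha⟩, ⟨b, hb⟩⟩, he⟩ | ⟨a, b, hab, he⟩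
  · simp only [drumSrc, drumTgt, Sym2.eq_iff, drumMk_eq_iff, Fin.val_zero] at he
    omega
  · simp only [drumSrc, drumTgt, Sym2.eq_iff, drumMk_eq_iff, Fin.val_zero, Fin.val_castSucc,
      Fin.val_succ] at he
    omega
  · rw [extraZ, SimpleGraph.fromRel_adj] at hab
    simp only [Sym2.eq_iff, drumMk_eq_iff, Fin.val_zero] at he
    omega

theorem graphY_ne_graphZ {k : ℕ} (hk : 2 ≤ k) : graphY k ≠ graphZ k := by
  intro h
  have key (c : ℕ) (hc : c < 2 * k + 2) (h1 : 2 ≤ c) (h2 : c ≤ 2 * k)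
      (hY : (extraY k).Adj 0 ⟨c, hc⟩) : False := by
    refine not_graphZ_adj hk (c := ⟨c, hc⟩) h1 h2 ?_
    rw [← h, graphY, drumWith_adj_iff hk]
    exact Or.inr ⟨_, _, hY, rfl⟩
  rcases Nat.even_or_odd k with he | ho
  · refine key (k + 1) (by omega) (by omega) (by omega) ?_
    rw [extraY, SimpleGraph.fromRel_adj]
    exact ⟨by simp [Fin.ext_iff], Or.inl (Or.inl ⟨he, by simp⟩)⟩
  · refine key k (by omega) (by omega) (by omega) ?_
    rw [extraY, SimpleGraph.fromRel_adj]
    exact ⟨by rw [Ne, Fin.ext_iff]; simp only [Fin.val_zero]; omega,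
      Or.inl (Or.inr ⟨ho, by simp, by simp⟩)⟩

theorem mainTheorem9 (k : ℕ) (hk : 2 ≤ k) :
    (∃ f : DrumVertex k ≃ schrijverSet (2 * k + 2) k,
      graphY k ≤ (schrijverGraph (2 * k + 2) k).comap f ∧
      graphZ k ≤ (schrijverGraph (2 * k + 2) k).comap f) ∧
    graphY k ≠ graphZ k ∧
    Quadrangulates (graphY k) KleinBottle ∧
    Quadrangulates (graphZ k) RealProjectivePlane := by
  refine ⟨⟨Equiv.ofBijective (drumStable k) ⟨drumStable_injective k, drumStable_surjective k⟩,
    drumWith_le_comap hk extraY_adj_odd, drumWith_le_comap hk extraZ_adj_odd⟩,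
    graphY_ne_graphZ hk, graphY_quadrangulates hk, graphZ_quadrangulates hk⟩
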